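/- Let $F$ be a free group of finite rank $r\ge 0$ with a fixed basis $x_1,\dots,x_r$, and let $|g|$ denote the length of $g\in F$ in the word metric relative to this basis. A finitely generated subgroup of $F$ is given by a finite list of words $h_1,\dots,h_n$ in the letters $x_i^{\pm1}$, not necessarily reduced; the size of the input is the sum of the lengths of these words plus $n$. (1) The shortest nontrivial element problem in $F$ is in $\mathbf P$: there is a (multi-stack) Turing machine which, on input $h_1,\dots,h_n$, runs in time polynomial in the size of the input and outputs a word representing an element of minimal length $|h|$ among all $h\in H\smallsetminus\{1\}$, where $H=\langle h_1,\dots,h_n\rangle$, or reports that $H$ is trivial. (The basis is fixed; the machine and the polynomial may depend on $r$.) (2) Let $\Gamma$ be the Stallings graph of $H$, that is, the graph obtained by folding the bouquet of loops at a base vertex $1_\Gamma$ that read the freely reduced forms of $h_1,\dots,h_n$. A word $w$ is a geodesic word representing a shortest nontrivial element of $H$ if and only if $w$ is the label of a shortest nonempty reduced loop of $\Gamma$ at $1_\Gamma$ (a reduced loop is a closed path in which no edge is immediately followed by the same edge in the opposite direction). -/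

import Mathlib

/-! ### Words, word metric, shortest elements -/

/-- Words in the letters `x i` (written `(i, true)`) and `(x i)⁻¹` (written `(i, false)`). -/
abbrev GroupWord (ι : Type) : Type := List (ι × Bool)

section WordMetric

variable {ι : Type} {G : Type*} [Group G]

/-- The element of `G` represented by a word in the generators `a i` and their inverses. -/
def evalWord (a : ι → G) (w : GroupWord ι) : G :=
  (w.map fun l => if l.2 then a l.1 else (a l.1)⁻¹).prod

/-- The length of `g` in the word metric relative to the generating family `a`. -/
noncomputable def wordLength (a : ι → G) (g : G) : ℕ :=
  sInf {n | ∃ w : GroupWord ι, evalWord a w = g ∧ w.length = n}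

/-- A word is geodesic if it is a shortest word representing its element. -/
def IsGeodesicWord (a : ι → G) (w : GroupWord ι) : Prop :=
  ∀ u : GroupWord ι, evalWord a u = evalWord a w → w.length ≤ u.length

/-- The subgroup generated by the elements that the words `hs` represent. -/
def wordSubgroup (a : ι → G) (hs : List (GroupWord ι)) : Subgroup G :=
  Subgroup.closure {g | ∃ h ∈ hs, evalWord a h = g}

/-- `g` is a shortest nontrivial element of `H` in the word metric of `G`. -/
def IsShortestNontrivial (a : ι → G) (H : Subgroup G) (g : G) : Prop :=
  g ∈ H ∧ g ≠ 1 ∧ ∀ k ∈ H, k ≠ 1 → wordLength a g ≤ wordLength a k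

/-- The correct answers to the instance `hs` of the shortest element problem: a word representing
a shortest nontrivial element of the subgroup, or `none` if the subgroup is trivial. -/
def IsShortestElementAnswer (a : ι → G) (hs : List (GroupWord ι)) :
    Option (GroupWord ι) → Prop
  | none => wordSubgroup a hs = ⊥
  | some w => IsShortestNontrivial a (wordSubgroup a hs) (evalWord a w)

/-- An instance is written on the input stack as the sequence of its words, each followed by the
end marker `none`; so the input size is the total length of the words plus their number. -/
def encodeInstance (hs : List (GroupWord ι)) : List (Option (ι × Bool)) :=
  hs.flatMap fun h => h.map some ++ [none]

/-- The answer `none` is written as the empty string, the answer `some w` as a marker followed by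
the letters of `w`. -/
def encodeAnswer : Option (GroupWord ι) → List (Option (ι × Bool))
  | none => []
  | some w => none :: w.map some

/-- The shortest element problem in the group `G` with the fixed generating family `a`
is in **P** (as a search problem): some function that gives a correct answer on every instance is
computed by a Turing machine in time polynomial in the size of the instance. -/
def ShortestElementProblemInP (a : ι → G) : Prop :=
  ∃ f : List (GroupWord ι) → Option (GroupWord ι),
    (∀ hs, IsShortestElementAnswer a hs (f hs)) ∧
    Nonempty (Turing.TM2ComputableInPolyTime encodeInstance encodeAnswer f)

end WordMetric

/-! ### Labelled graphs, folding, Stallings graphs -/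

/-- A based directed graph with edges labelled in `ι`: `E u i v` says that there is an edge
from `u` to `v` with label `i`. -/
structure LabelledGraph (ι : Type) where
  V : Type
  base : V
  E : V → ι → V → Prop

/-- A traversal of an edge from `src` to `tgt`, reading the letter `lab`. -/
structure LabelledStep (V ι : Type) where
  src : V
  lab : ι × Bool
  tgt : V

namespace LabelledStep

/-- The same edge traversed in the opposite direction. -/
def inv {V ι : Type} (d : LabelledStep V ι) : LabelledStep V ι :=
  ⟨d.tgt, (d.lab.1, !d.lab.2), d.src⟩

end LabelledStep

namespace LabelledGraph

variable {ι : Type} (Γ : LabelledGraph ι)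

/-- The letter `l` can be read from `u` to `v`: along an edge labelled `i` if `l = (i, true)`,
against such an edge if `l = (i, false)`. -/
def Reads (u : Γ.V) (l : ι × Bool) (v : Γ.V) : Prop :=
  if l.2 then Γ.E u l.1 v else Γ.E v l.1 u

/-- `Γ.IsPath u p v`: the list of steps `p` is a path in `Γ` from `u` to `v`. -/
inductive IsPath : Γ.V → List (LabelledStep Γ.V ι) → Γ.V → Prop
  | nil (v : Γ.V) : IsPath v [] v
  | cons {u v w : Γ.V} {l : ι × Bool} {p : List (LabelledStep Γ.V ι)} :
      Γ.Reads u l v → IsPath v p w → IsPath u (⟨u, l, v⟩ :: p) w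

/-- A reduced loop at the base vertex: a closed path there without backtracking, that is,
without an edge immediately followed by the same edge in the opposite direction. -/
def IsReducedLoop (p : List (LabelledStep Γ.V ι)) : Prop :=
  Γ.IsPath Γ.base p Γ.base ∧ p.IsChain fun d e => e ≠ d.inv

/-- A shortest one among the nonempty reduced loops at the base vertex. -/
def IsShortestReducedLoop (p : List (LabelledStep Γ.V ι)) : Prop :=
  Γ.IsReducedLoop p ∧ p ≠ [] ∧ ∀ q, Γ.IsReducedLoop q → q ≠ [] → p.length ≤ q.length

/-- The vertex identifications forced by folding: the smallest equivalence relation such that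
whenever the same letter can be read from two identified vertices, its end vertices
are identified. -/
inductive FoldRel : Γ.V → Γ.V → Prop
  | refl (u : Γ.V) : FoldRel u u
  | symm {u v : Γ.V} : FoldRel u v → FoldRel v u
  | trans {u v w : Γ.V} : FoldRel u v → FoldRel v w → FoldRel u w
  | fold {u u' v v' : Γ.V} {l : ι × Bool} :
      FoldRel u u' → Γ.Reads u l v → Γ.Reads u' l v' → FoldRel v v'

def foldSetoid : Setoid Γ.V :=
  ⟨Γ.FoldRel, ⟨FoldRel.refl, FoldRel.symm, FoldRel.trans⟩⟩

/-- The graph obtained from `Γ` by performing all foldings. -/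
def folded : LabelledGraph ι where
  V := Quotient Γ.foldSetoid
  base := Quotient.mk Γ.foldSetoid Γ.base
  E := fun p i q => ∃ u v, Quotient.mk Γ.foldSetoid u = p ∧ Quotient.mk Γ.foldSetoid v = q ∧
    Γ.E u i v

end LabelledGraph

section Stallings

variable {ι : Type}

/-- Vertices of the bouquet of loops reading the words `hs`: the base vertex `none`, and
`ℓ - 1` further vertices on the loop of a word of length `ℓ` (none if `ℓ = 0`). -/
abbrev BouquetVertex (hs : List (GroupWord ι)) : Type :=
  Option (Σ i : Fin hs.length, Fin ((hs.get i).length - 1))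

/-- The `j`-th vertex along the `i`-th loop, for `0 ≤ j ≤ ℓ`; it is the base vertex for
`j = 0` and for `j = ℓ`. -/
def bouquetPoint (hs : List (GroupWord ι)) (i : Fin hs.length) (j : ℕ) : BouquetVertex hs :=
  if hj : 0 < j ∧ j < (hs.get i).length then some ⟨i, ⟨j - 1, by omega⟩⟩ else none

/-- The bouquet of loops at the base vertex reading the words `hs`. The `j`-th edge of the `i`-th
loop points forward or backward according to the sign of the `j`-th letter of the word. -/
def bouquet (hs : List (GroupWord ι)) : LabelledGraph ι where
  V := BouquetVertex hs
  base := none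
  E := fun u x v => ∃ (i : Fin hs.length) (j : Fin (hs.get i).length),
    ((hs.get i).get j = (x, true) ∧ u = bouquetPoint hs i (j : ℕ) ∧ v = bouquetPoint hs i ((j : ℕ) + 1)) ∨
    ((hs.get i).get j = (x, false) ∧ u = bouquetPoint hs i ((j : ℕ) + 1) ∧ v = bouquetPoint hs i (j : ℕ))

/-- The Stallings graph of the subgroup of a free group generated by the words `hs`: the bouquet
of loops reading their freely reduced forms, folded. -/
def stallingsGraph [DecidableEq ι] (hs : List (GroupWord ι)) : LabelledGraph ι :=
  (bouquet (hs.map FreeGroup.reduce)).folded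

end Stallings

/-! Graph side. Folding makes a labelled graph deterministic: a letter leads from a vertex to at
most one vertex. In such a graph an edge can only be followed by a step with the inverse letter if
that step is the edge traversed backwards, so reduced loops are the same as loops with reduced
labels (`exists_isReducedLoop_iff`). The labels of loops at the base vertex lie in `H` because the
vertices map compatibly to the cosets of `H` (`IsCosetMap`), and folding respects this map.
Conversely, determinism lets one cancel inside labels of loops, so the elements whose reduced words
label loops form a subgroup; it contains the generators, hence `H` (`walk_base_iff`). Since in a
free group the geodesic words are the reduced ones and word length is the length of the reduced
word, this gives part (2).

Algorithm. Build a graph from the words, identify conflicting endpoints until it is deterministic,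
and search for a shortest nonempty loop with reduced label. How a reduced path may be continued
depends only on its last edge, so the breadth-first search keeps one path per edge and stage; its
state stays polynomial even if there are exponentially many paths. The same coset argument proves it
correct (`solve_spec`). The edge list is at least as long as each generator, so as many search steps
as there are edges suffice.

Complexity. All data are binary trees, serialized in preorder on a stack; the code is prefix-free,
so a tree on top of a stack can be moved, copied or deleted without touching what lies below.
Structured programs on these stacks compile to `TM2` machines with exact step counts (`Run.reach`).
The functions they compute in polynomial time are closed under composition, pairing, branching and
iteration with bounded intermediate size (`PFun.iterate`), whence the calculus `PT`, in which the
algorithm is shown polynomial (`solve_PT`). -/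

/-! ### Structured programs for multi-stack machines -/

namespace StackProg

open Turing Turing.TM2 StateTransition

/-- The stacks with alphabet `Bool`: a main stack, two auxiliary ones, and a counter. -/
inductive Aux : Type
  | m | t | u | c
  deriving DecidableEq

instance : Fintype Aux := ⟨{.m, .t, .u, .c}, fun x => by cases x <;> simp⟩

/-- The alphabets of the machine: `Fin N` for the input-output stack `none`. -/
def Alph (N : ℕ) : Option Aux → Type
  | none => Fin N
  | some _ => Bool

/-- The register: the bit read last, and a letter. -/
abbrev Reg (N : ℕ) : Type := Option Bool × Fin N

/-- Structured programs. -/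
inductive Prog (N : ℕ) : Type
  | push (j : Aux) (f : Reg N → Bool)
  | pop (j : Aux) (f : Reg N → Option Bool → Reg N)
  | write (f : Reg N → Fin N)
  | read (f : Reg N → Option (Fin N) → Reg N)
  | load (f : Reg N → Reg N)
  | seq (p q : Prog N)
  | ite (f : Reg N → Bool) (p q : Prog N)
  | loop (f : Reg N → Bool) (p : Prog N)

variable {N : ℕ}

/-- The control points of a program. -/
def Prog.Lab : Prog N → Type
  | .push _ _ => Unit
  | .pop _ _ => Unit
  | .write _ => Unit
  | .read _ => Unit
  | .load _ => Unit
  | .seq p q => p.Lab ⊕ q.Lab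
  | .ite _ p q => Option (p.Lab ⊕ q.Lab)
  | .loop _ p => Option p.Lab

theorem Prog.finite_lab (p : Prog N) : Finite p.Lab := by
  induction p with
  | push | pop | write | read | load => exact inferInstanceAs (Finite Unit)
  | seq p q hp hq => exact inferInstanceAs (Finite (p.Lab ⊕ q.Lab))
  | ite f p q hp hq => exact inferInstanceAs (Finite (Option (p.Lab ⊕ q.Lab)))
  | loop f p hp => exact inferInstanceAs (Finite (Option p.Lab))

/-- The control point at which a program starts. -/
def Prog.entry : (p : Prog N) → p.Lab
  | .push _ _ => ()
  | .pop _ _ => ()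
  | .write _ => ()
  | .read _ => ()
  | .load _ => ()
  | .seq p _ => .inl p.entry
  | .ite _ _ _ => none
  | .loop _ _ => none

/-- The code of a program whose control points are placed in `Λ` by `emb`, and which jumps to
`exit` when it is finished. -/
def Prog.code {Λ : Type} : (p : Prog N) → (p.Lab → Λ) → Λ → p.Lab → Stmt (Alph N) Λ (Reg N)
  | .push j f, _, exit, _ => .push (some j) f (.goto fun _ => exit)
  | .pop j f, _, exit, _ => .pop (some j) f (.goto fun _ => exit)
  | .write f, _, exit, _ => .push none f (.goto fun _ => exit)
  | .read f, _, exit, _ => .pop none f (.goto fun _ => exit)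
  | .load f, _, exit, _ => .load f (.goto fun _ => exit)
  | .seq p q, emb, _, .inl l => p.code (emb ∘ .inl) (emb (.inr q.entry)) l
  | .seq _ q, emb, exit, .inr l => q.code (emb ∘ .inr) exit l
  | .ite f p q, emb, _, none =>
      .branch f (.goto fun _ => emb (some (.inl p.entry))) (.goto fun _ => emb (some (.inr q.entry)))
  | .ite _ p _, emb, exit, some (.inl l) => p.code (emb ∘ some ∘ .inl) exit l
  | .ite _ _ q, emb, exit, some (.inr l) => q.code (emb ∘ some ∘ .inr) exit l
  | .loop f p, emb, exit, none =>
      .branch f (.goto fun _ => emb (some p.entry)) (.goto fun _ => exit)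
  | .loop _ p, emb, _, some l => p.code (emb ∘ some) (emb none) l

/-- The contents of the stacks. -/
structure Mem (N : ℕ) : Type where
  io : List (Fin N)
  bits : Aux → List Bool

/-- The contents of the stacks as a dependent function. -/
def Mem.stk (S : Mem N) : ∀ k, List (Alph N k)
  | none => S.io
  | some j => S.bits j

theorem Mem.stk_set (S : Mem N) (j : Aux) (l : List Bool) :
    Function.update S.stk (some j) l = Mem.stk ⟨S.io, Function.update S.bits j l⟩ := by
  funext k
  rcases k with _ | i
  · exact Function.update_of_ne (by simp) _ _
  · by_cases h : i = j
    · subst h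
      exact (Function.update_self _ _ _).trans (Function.update_self (β := fun _ => List Bool) _ _ _).symm
    · exact (Function.update_of_ne (by simpa using h) _ _).trans
        (Function.update_of_ne (β := fun _ => List Bool) h _ _).symm

theorem Mem.stk_set_io (S : Mem N) (l : List (Fin N)) :
    Function.update S.stk none l = Mem.stk ⟨l, S.bits⟩ := by
  funext k
  rcases k with _ | i
  · exact Function.update_self _ _ _
  · exact Function.update_of_ne (by simp) _ _

/-- `Run p v S n v' S'`: started with register `v` and stacks `S`, the program `p` stops after `n`
steps with register `v'` and stacks `S'`. -/
inductive Run : Prog N → Reg N → Mem N → ℕ → Reg N → Mem N → Prop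
  | push (j f v S) : Run (.push j f) v S 1 v ⟨S.io, Function.update S.bits j (f v :: S.bits j)⟩
  | pop (j f v S) : Run (.pop j f) v S 1 (f v (S.bits j).head?)
      ⟨S.io, Function.update S.bits j (S.bits j).tail⟩
  | write (f v S) : Run (.write f) v S 1 v ⟨f v :: S.io, S.bits⟩
  | read (f v S) : Run (.read f) v S 1 (f v S.io.head?) ⟨S.io.tail, S.bits⟩
  | load (f v S) : Run (.load f) v S 1 (f v) S
  | seq {p q v S n v' S' n' v'' S''} : Run p v S n v' S' → Run q v' S' n' v'' S'' →
      Run (.seq p q) v S (n + n') v'' S''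
  | ite_true {f p q v S n v' S'} : f v = true → Run p v S n v' S' →
      Run (.ite f p q) v S (n + 1) v' S'
  | ite_false {f p q v S n v' S'} : f v = false → Run q v S n v' S' →
      Run (.ite f p q) v S (n + 1) v' S'
  | loop_false {f p v S} : f v = false → Run (.loop f p) v S 1 v S
  | loop_true {f p v S n v' S' n' v'' S''} : f v = true → Run p v S n v' S' →
      Run (.loop f p) v' S' n' v'' S'' → Run (.loop f p) v S (n + n' + 1) v'' S''

/-- `Reach m a n b`: the machine `m` gets from `a` to `b` in exactly `n` steps. -/
def Reach {Λ : Type} (m : Λ → Stmt (Alph N) Λ (Reg N)) (a : Cfg (Alph N) Λ (Reg N)) (n : ℕ)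
    (b : Cfg (Alph N) Λ (Reg N)) : Prop :=
  (flip bind (TM2.step m))^[n] (some a) = some b

theorem Reach.trans {Λ : Type} {m : Λ → Stmt (Alph N) Λ (Reg N)} {a b c : Cfg (Alph N) Λ (Reg N)}
    {i j : ℕ}
    (h : Reach m a i b) (h' : Reach m b j c) : Reach m a (i + j) c := by
  unfold Reach at *
  rw [add_comm, Function.iterate_add_apply, h, h']

theorem Reach.single {Λ : Type} {m : Λ → Stmt (Alph N) Λ (Reg N)} {l : Λ}
    {s : Stmt (Alph N) Λ (Reg N)} (h : m l = s)
    (v : Reg N) (S : ∀ k, List (Alph N k)) : Reach m ⟨some l, v, S⟩ 1 (stepAux s v S) := h ▸ rfl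

/-- The induction is over the run, with the exit label left arbitrary: a subprogram exits into the
entry of the next one, and a loop body exits to the head of its loop. Each primitive instruction,
and each test, is one machine step ending in a jump. -/
theorem Run.reach {Λ : Type} {m : Λ → Stmt (Alph N) Λ (Reg N)} {p : Prog N} {v v' : Reg N} {S S' : Mem N}
    {n : ℕ} (h : Run p v S n v' S') (emb : p.Lab → Λ) (exit : Λ)
    (hm : ∀ l, m (emb l) = p.code emb exit l) :
    Reach m ⟨some (emb p.entry), v, S.stk⟩ n ⟨some exit, v', S'.stk⟩ := by
  induction h generalizing exit with
  | push j f v S => rw [← Mem.stk_set]; exact Reach.single (hm ()) v S.stk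
  | pop j f v S => rw [← Mem.stk_set]; exact Reach.single (hm ()) v S.stk
  | write f v S => rw [← Mem.stk_set_io S (f v :: S.io)]; exact Reach.single (hm ()) v S.stk
  | read f v S => rw [← Mem.stk_set_io S S.io.tail]; exact Reach.single (hm ()) v S.stk
  | load f v S => exact Reach.single (hm ()) v S.stk
  | seq _ _ ih ih' =>
    exact (ih (emb ∘ .inl) _ fun l => hm (.inl l)).trans (ih' (emb ∘ .inr) _ fun l => hm (.inr l))
  | @ite_true f p q v S n v' S' hf _ ih =>
    have h1 := Reach.single (hm none) v S.stk
    simp only [Prog.code, stepAux, hf, cond_true] at h1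
    rw [add_comm]
    exact h1.trans (ih (emb ∘ some ∘ .inl) _ fun l => hm (some (.inl l)))
  | @ite_false f p q v S n v' S' hf _ ih =>
    have h1 := Reach.single (hm none) v S.stk
    simp only [Prog.code, stepAux, hf, cond_false] at h1
    rw [add_comm]
    exact h1.trans (ih (emb ∘ some ∘ .inr) _ fun l => hm (some (.inr l)))
  | @loop_false f p v S hf =>
    have h1 := Reach.single (hm none) v S.stk
    simp only [Prog.code, stepAux, hf, cond_false] at h1
    exact h1
  | @loop_true f p v S n v' S' n' v'' S'' hf _ _ ih ih' =>
    have h1 := Reach.single (hm none) v S.stk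
    simp only [Prog.code, stepAux, hf, cond_true] at h1
    rw [add_comm]
    exact h1.trans ((ih (emb ∘ some) _ fun l => hm (some l)).trans (ih' emb _ hm))

/-- The machine that runs a program and halts. -/
def Prog.machine (p : Prog N) : Option p.Lab → Stmt (Alph N) (Option p.Lab) (Reg N)
  | none => .halt
  | some l => p.code some none l

/-- The additional step executes `halt` at the exit label. -/
theorem Run.reach_halt {p : Prog N} {v v' : Reg N} {S S' : Mem N} {n : ℕ}
    (h : Run p v S n v' S') :
    Reach p.machine ⟨some (some p.entry), v, S.stk⟩ (n + 1) ⟨none, v', S'.stk⟩ :=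
  (h.reach some none fun _ => rfl).trans (Reach.single rfl _ _)

end StackProg

/-! ### Binary trees on a multi-stack machine -/

namespace StackProg

open Turing Turing.TM2

/-- Binary trees, the universal data type of the programs below. -/
inductive T : Type
  | nil : T
  | cons (a b : T) : T

namespace T

/-- The preorder serialization of a tree. -/
def ser : T → List Bool
  | nil => [false]
  | cons a b => true :: (ser a ++ ser b)

def size : T → ℕ
  | nil => 1
  | cons a b => a.size + b.size + 1

def left : T → T
  | nil => nil
  | cons a _ => a

def right : T → T
  | nil => nil
  | cons _ b => b

/-- The length of the rightmost branch of a tree. -/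
def spine : T → ℕ
  | nil => 0
  | cons _ b => b.spine + 1

theorem length_ser (a : T) : a.ser.length = a.size := by
  induction a with
  | nil => rfl
  | cons a b ha hb => simp [ser, size, ha, hb]

theorem ser_cons_append (a b : T) (r : List Bool) :
    (cons a b).ser ++ r = true :: (a.ser ++ (b.ser ++ r)) := by simp [ser]

theorem size_pos (a : T) : 1 ≤ a.size := by cases a <;> simp [size]

theorem spine_lt_size (a : T) : a.spine < a.size := by
  induction a with
  | nil => simp [spine, size]
  | cons a b ha hb => simp only [spine, size]; omega

end T

variable {N : ℕ}

/-- The stacks with the given contents. -/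
def bits (m t u c : List Bool) : Aux → List Bool
  | .m => m
  | .t => t
  | .u => u
  | .c => c

/-- The stacks with the given contents. -/
abbrev st (io : List (Fin N)) (m t u c : List Bool) : Mem N := ⟨io, bits m t u c⟩

section update

variable (m t u c x : List Bool)

@[simp] theorem bits_update_m : Function.update (bits m t u c) .m x = bits x t u c := by
  funext k; cases k <;> rfl
@[simp] theorem bits_update_t : Function.update (bits m t u c) .t x = bits m x u c := by
  funext k; cases k <;> rfl
@[simp] theorem bits_update_u : Function.update (bits m t u c) .u x = bits m t x c := by
  funext k; cases k <;> rfl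
@[simp] theorem bits_update_c : Function.update (bits m t u c) .c x = bits m t u x := by
  funext k; cases k <;> rfl
@[simp] theorem bits_m : bits m t u c .m = m := rfl
@[simp] theorem bits_t : bits m t u c .t = t := rfl
@[simp] theorem bits_u : bits m t u c .u = u := rfl
@[simp] theorem bits_c : bits m t u c .c = c := rfl

end update

theorem Run.of_eq {p : Prog N} {v v' : Reg N} {S S' S'' : Mem N} {n n' : ℕ}
    (h : Run p v S n v' S') (hn : n = n') (hS : S' = S'') : Run p v S n' v' S'' := hn ▸ hS ▸ h

/-- `Ex p S n S'`: whatever the register holds, `p` turns the stacks `S` into `S'` in at most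
`n` steps. -/
def Ex (p : Prog N) (S : Mem N) (n : ℕ) (S' : Mem N) : Prop :=
  ∀ v, ∃ k ≤ n, ∃ v', Run p v S k v' S'

theorem Ex.mono {p : Prog N} {S S' : Mem N} {n n' : ℕ} (h : Ex p S n S') (hn : n ≤ n') :
    Ex p S n' S' := fun v =>
  let ⟨k, hk, v', hr⟩ := h v
  ⟨k, hk.trans hn, v', hr⟩

theorem Ex.seq {p q : Prog N} {S S' S'' : Mem N} {n n' : ℕ} (h : Ex p S n S')
    (h' : Ex q S' n' S'') : Ex (.seq p q) S (n + n') S'' := fun v =>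
  let ⟨_, hk, v', hr⟩ := h v
  let ⟨_, hk', v'', hr'⟩ := h' v'
  ⟨_, add_le_add hk hk', v'', .seq hr hr'⟩

theorem Ex.push (j : Aux) (x : Bool) (S : Mem N) :
    Ex (.push j fun _ => x) S 1 ⟨S.io, Function.update S.bits j (x :: S.bits j)⟩ := fun v =>
  ⟨1, le_rfl, v, .push j (fun _ => x) v S⟩

/-- Read the top of the stack `j` off into the register. -/
def popBit (j : Aux) : Prog N := .pop j fun v b => (b, v.2)

/-- Push the bit in the register on the stack `j`. -/
def pushBit (j : Aux) : Prog N := .push j fun v => v.1.getD false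

theorem Ex.pushMain (x : Bool) (io : List (Fin N)) (r t u c : List Bool) :
    Ex (.push .m fun _ => x) (st io r t u c) 1 (st io (x :: r) t u c) := by
  simpa using Ex.push .m x (st io r t u c)

theorem Run.popMain (v : Reg N) (x : Bool) (io : List (Fin N)) (r t u c : List Bool) :
    Run (popBit .m) v (st io (x :: r) t u c) 1 (some x, v.2) (st io r t u c) :=
  (Run.pop .m _ _ _).of_eq rfl (by simp)

/-- Look at the top of the stack `j`. -/
def peekBit (j : Aux) : Prog N := .seq (popBit j) (.ite (fun v => v.1.isSome) (pushBit j) (.load id))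

theorem Run.popBit (j : Aux) (b : Option Bool) (x : Fin N) (io : List (Fin N)) (s : Aux → List Bool) :
    Run (popBit j) (b, x) ⟨io, s⟩ 1 ((s j).head?, x) ⟨io, Function.update s j (s j).tail⟩ :=
  .pop j _ _ _

theorem Run.pushBit (j : Aux) (b : Bool) (x : Fin N) (io : List (Fin N)) (s : Aux → List Bool) :
    Run (pushBit j) (some b, x) ⟨io, s⟩ 1 (some b, x) ⟨io, Function.update s j (b :: s j)⟩ :=
  .push j _ _ _

/-- The dummy `load id` for an empty stack makes both branches equally long, so that the count 3 is
exact. -/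
theorem Run.peekBit (j : Aux) (b : Option Bool) (x : Fin N) (io : List (Fin N)) (s : Aux → List Bool) :
    Run (peekBit j) (b, x) ⟨io, s⟩ 3 ((s j).head?, x) ⟨io, s⟩ := by
  have h1 := Run.popBit j b x io s
  rcases h : s j with _ | ⟨d, l⟩
  · have h2 := Run.seq h1 (.ite_false (f := fun v => v.1.isSome) (p := StackProg.pushBit j)
      (by simp [h]) (.load id _ _))
    simp only [h, List.head?_nil, List.tail_nil, id] at h2
    rwa [← h, Function.update_eq_self] at h2
  · have h2 := Run.seq h1 (.ite_true (f := fun v => v.1.isSome) (q := Prog.load id)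
      (by simp [h]) (by rw [h]; exact .pushBit j _ _ _ _))
    simp only [List.tail_cons, Function.update_self, Function.update_idem] at h2
    rw [← h, Function.update_eq_self] at h2
    exact h2

/-- Move the contents of the stack `i` to the stack `j`, reversing their order. -/
def moveAll (i j : Aux) : Prog N :=
  .seq (popBit i) (.loop (fun v => v.1.isSome) (.seq (pushBit j) (popBit i)))

theorem Ex.moveAll {i j : Aux} (hij : i ≠ j) (io : List (Fin N)) (s : Aux → List Bool) :
    Ex (moveAll i j) ⟨io, s⟩ (3 * (s i).length + 2)
      ⟨io, Function.update (Function.update s i []) j ((s i).reverse ++ s j)⟩ := by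
  -- When the loop is tested, the head of `l` is already in the register, so the stack `i` holds
  -- only `l.tail`.
  have key : ∀ (l : List Bool) (x : Fin N) (s : Aux → List Bool), s i = l.tail →
      ∃ v', Run (.loop (fun v => v.1.isSome) (.seq (pushBit j) (popBit i))) (l.head?, x) ⟨io, s⟩
        (3 * l.length + 1) v' ⟨io, Function.update (Function.update s i []) j (l.reverse ++ s j)⟩ := by
    intro l
    induction l with
    | nil =>
      intro x s hs
      refine ⟨_, (Run.loop_false rfl).of_eq rfl ?_⟩
      congr 1
      funext k
      by_cases hj : k = j
      · subst hj; simp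
      · by_cases hi : k = i
        · subst hi; simpa [hj] using hs
        · simp [hj, hi]
    | cons b l ih =>
      intro x s hs
      have h1 := Run.seq (Run.pushBit j b x io s) (Run.popBit i _ _ _ _)
      simp only [Function.update_of_ne hij, hs, List.tail_cons] at h1
      obtain ⟨v', h2⟩ := ih x (Function.update (Function.update s j (b :: s j)) i l.tail) (by simp)
      refine ⟨v', ?_⟩
      have h3 := Run.loop_true (f := fun v : Reg N => v.1.isSome) rfl h1 h2
      refine h3.of_eq ?_ ?_
      · simp only [List.length_cons]; omega
      · congr 1
        funext k
        by_cases hj : k = j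
        · subst hj; simp [hij.symm]
        · by_cases hi : k = i
          · subst hi; simp [hj]
          · simp [hj, hi]
  intro v
  have h1 := Run.popBit i v.1 v.2 io s
  obtain ⟨v', h2⟩ := key (s i) v.2 (Function.update s i (s i).tail) (by simp)
  have h3 := Run.seq h1 h2
  simp only [Function.update_of_ne hij.symm, Function.update_idem] at h3
  exact ⟨_, by omega, v', h3⟩

/-- Move the tree on top of the main stack to the stack `t`, reversing its serialization. -/
def moveTree : Prog N :=
  .seq (.push .c fun _ => true) <| .seq (peekBit .c) <|
    .loop (fun v => v.1.isSome) <| .seq (popBit .m) <| .seq (pushBit .t) <|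
      .seq (.ite (fun v => v.1 = some true) (.push .c fun _ => true)
        (.pop .c fun v _ => v)) (peekBit .c)

/-- The counter stack holds in unary the number of subtrees still to be read: a bit `true` replaces
one pending subtree by two, a bit `false` completes one. The tree ends when the counter is empty.
Each bit costs 7 steps for the body and 1 for the test. -/
theorem Ex.moveTree (io : List (Fin N)) (a : T) (m t u : List Bool) :
    Ex moveTree (st io (a.ser ++ m) t u []) (8 * a.size + 5) (st io m (a.ser.reverse ++ t) u []) := by
  -- Stated in continuation form: a run of the loop from the point where `a` has been consumed
  -- extends to one from the point before. Thus the two induction hypotheses for a `cons` compose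
  -- directly.
  have key : ∀ (a : T) (m t cs : List Bool) (x : Fin N) (n : ℕ) v' S',
      Run (.loop (fun v => v.1.isSome) <| .seq (popBit .m) <| .seq (pushBit .t) <|
        .seq (.ite (fun v => v.1 = some true) (.push .c fun _ => true)
        (.pop .c fun v _ => v)) (peekBit .c)) (cs.head?, x)
          (st io m (a.ser.reverse ++ t) u cs) n v' S' →
      Run (.loop (fun v => v.1.isSome) <| .seq (popBit .m) <| .seq (pushBit .t) <|
        .seq (.ite (fun v => v.1 = some true) (.push .c fun _ => true)
        (.pop .c fun v _ => v)) (peekBit .c)) (some true, x)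
          (st io (a.ser ++ m) t u (true :: cs)) (n + 8 * a.size) v' S' := by
    intro a
    induction a with
    | nil =>
      intro m t cs x n v' S' h
      have h3 : n + 8 * T.nil.size = 7 + n + 1 := by simp only [T.size]; omega
      rw [h3]
      refine Run.loop_true (n := 7) rfl ?_ h
      refine .seq (n := 1) (n' := 6) (.popBit _ _ _ _ _) (.seq (n := 1) (n' := 5) (.pushBit _ _ _ _ _) ?_)
      refine .seq (n := 2) (n' := 3) (.ite_false rfl (.pop _ _ _ _)) ?_
      simp only [bits_update_m, bits_update_t, bits_update_c, bits_m, bits_t, bits_c, T.ser]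
      exact .peekBit _ _ _ _ _
    | cons a b ha hb =>
      intro m t cs x n v' S' h
      have h2 := ha (b.ser ++ m) (true :: t) (true :: cs) x _ v' S'
        (hb m (a.ser.reverse ++ true :: t) cs x n v' S' (by simpa [T.ser] using h))
      have h3 : n + 8 * (T.cons a b).size = 7 + (n + 8 * b.size + 8 * a.size) + 1 := by
        simp only [T.size]; ring
      rw [h3]
      refine Run.loop_true (n := 7) rfl ?_ h2
      refine .seq (n := 1) (n' := 6) (.popBit _ _ _ _ _) (.seq (n := 1) (n' := 5) (.pushBit _ _ _ _ _) ?_)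
      refine .seq (n := 2) (n' := 3) (.ite_true rfl (.push _ _ _ _)) ?_
      simp only [bits_update_m, bits_update_t, bits_update_c, bits_m, bits_t, bits_c, T.ser,
        List.append_assoc, List.cons_append, List.tail_cons]
      exact .peekBit _ _ _ _ _
  intro v
  refine ⟨1 + (3 + (1 + 8 * a.size)), by omega, (none, v.2), .seq (.push _ _ _ _) (.seq (.peekBit _ _ _ _ _) ?_)⟩
  · simp only [bits_update_c, bits_c]
    exact key a m t [] v.2 1 (none, v.2) _ (.loop_false rfl)

/-- Delete the contents of the stack `t`. -/
def clear : Prog N := .seq (popBit .t) (.loop (fun v => v.1.isSome) (popBit .t))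

theorem Ex.clear (io : List (Fin N)) (m t u c : List Bool) :
    Ex clear (st io m t u c) (2 * t.length + 2) (st io m [] u c) := by
  have key : ∀ (t : List Bool) (x : Fin N), ∃ v', Run (.loop (fun v => v.1.isSome) (popBit .t))
      (t.head?, x) (st io m t.tail u c) (2 * t.length + 1) v' (st io m [] u c) := by
    intro t x
    induction t with
    | nil => exact ⟨_, .loop_false rfl⟩
    | cons b t ih =>
      obtain ⟨v', h⟩ := ih
      have h1 := Run.popBit .t (some b) x io (bits m t u c)
      simp only [bits_update_t, bits_t] at h1
      refine ⟨v', ?_⟩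
      have := Run.loop_true (f := fun v : Reg N => v.1.isSome) rfl h1 h
      exact this.of_eq (by simp only [List.length_cons]; omega) rfl
  intro v
  obtain ⟨v', h⟩ := key t v.2
  have h1 := Run.popBit .t v.1 v.2 io (bits m t u c)
  simp only [bits_update_t, bits_t] at h1
  exact ⟨_, by omega, v', .seq h1 h⟩

/-- Move the contents of the stack `t` both to the main stack and to the stack `u`. -/
def moveBoth : Prog N :=
  .seq (popBit .t)
    (.loop (fun v => v.1.isSome) (.seq (pushBit .m) (.seq (pushBit .u) (popBit .t))))

theorem Ex.moveBoth (io : List (Fin N)) (m t u c : List Bool) :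
    Ex moveBoth (st io m t u c) (4 * t.length + 2)
      (st io (t.reverse ++ m) [] (t.reverse ++ u) c) := by
  have key : ∀ (t m u : List Bool) (x : Fin N),
      ∃ v', Run (.loop (fun v => v.1.isSome) (.seq (pushBit .m) (.seq (pushBit .u) (popBit .t))))
      (t.head?, x) (st io m t.tail u c) (4 * t.length + 1) v'
      (st io (t.reverse ++ m) [] (t.reverse ++ u) c) := by
    intro t m u x
    induction t generalizing m u with
    | nil => exact ⟨_, .loop_false rfl⟩
    | cons b t ih =>
      obtain ⟨v', h⟩ := ih (b :: m) (b :: u)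
      have h1 := Run.seq (Run.pushBit .m b x io (bits m t u c)) (Run.seq (Run.pushBit .u b x io _)
        (Run.popBit .t _ _ _ _))
      simp only [bits_update_t, bits_t, bits_update_m, bits_m, bits_update_u, bits_u] at h1
      refine ⟨v', ?_⟩
      have := Run.loop_true (f := fun v : Reg N => v.1.isSome) rfl h1 h
      refine this.of_eq ?_ ?_
      · simp only [List.length_cons]; omega
      · simp
  intro v
  obtain ⟨v', h⟩ := key t m u v.2
  have h1 := Run.popBit .t v.1 v.2 io (bits m t u c)
  simp only [bits_update_t, bits_t] at h1
  exact ⟨_, by omega, v', .seq h1 h⟩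

/-- Delete the tree on top of the main stack. -/
def drop : Prog N := .seq moveTree clear

theorem Ex.drop (io : List (Fin N)) (a : T) (m : List Bool) :
    Ex drop (st io (a.ser ++ m) [] [] []) (20 * a.size) (st io m [] [] []) := by
  refine ((Ex.moveTree io a m [] []).seq (Ex.clear io m _ [] [])).mono ?_
  have := a.size_pos
  simp [T.length_ser]; omega

/-- Duplicate the tree on top of the main stack. -/
def dup : Prog N := .seq moveTree (.seq moveBoth (.seq (moveAll .u .t) (moveAll .t .m)))

theorem Ex.dup (io : List (Fin N)) (a : T) (m : List Bool) :
    Ex dup (st io (a.ser ++ m) [] [] []) (40 * a.size) (st io (a.ser ++ (a.ser ++ m)) [] [] []) := by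
  have h1 := Ex.moveTree io a m [] []
  have h2 := Ex.moveBoth io m (a.ser.reverse ++ []) [] []
  have h3 := Ex.moveAll (i := .u) (j := .t) (by simp) io (bits (a.ser ++ m) [] a.ser [])
  have h4 := Ex.moveAll (i := .t) (j := .m) (by simp) io (bits (a.ser ++ m) (a.ser.reverse) [] [])
  simp only [bits_update_t, bits_t, bits_update_m, bits_m, bits_update_u, bits_u,
    List.append_nil, List.reverse_reverse, List.length_reverse, T.length_ser] at *
  refine (h1.seq (h2.seq (h3.seq h4))).mono ?_
  have := a.size_pos
  omega

/-- Exchange the two topmost trees on the main stack. -/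
def swap : Prog N :=
  .seq moveTree (.seq (moveAll .t .u) (.seq moveTree (.seq (moveAll .u .c)
    (.seq (moveAll .c .m) (moveAll .t .m)))))

/-- `moveTree` needs `c` empty as its counter, so the first tree waits on `u` while the second is
moved. It passes through `c` afterwards only to have its bits in the right order. -/
theorem Ex.swap (io : List (Fin N)) (a b : T) (m : List Bool) :
    Ex swap (st io (a.ser ++ (b.ser ++ m)) [] [] []) (40 * (a.size + b.size))
      (st io (b.ser ++ (a.ser ++ m)) [] [] []) := by
  have h1 := Ex.moveTree io a (b.ser ++ m) [] []
  have h2 := Ex.moveAll (i := .t) (j := .u) (by simp) io (bits (b.ser ++ m) (a.ser.reverse) [] [])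
  have h3 := Ex.moveTree io b m [] a.ser
  have h4 := Ex.moveAll (i := .u) (j := .c) (by simp) io (bits m (b.ser.reverse) a.ser [])
  have h5 := Ex.moveAll (i := .c) (j := .m) (by simp) io (bits m (b.ser.reverse) [] a.ser.reverse)
  have h6 := Ex.moveAll (i := .t) (j := .m) (by simp) io (bits (a.ser ++ m) (b.ser.reverse) [] [])
  simp only [bits_update_t, bits_t, bits_update_m, bits_m, bits_update_u, bits_u, bits_update_c, bits_c,
    List.append_nil, List.reverse_reverse, List.length_reverse, T.length_ser] at *
  refine (h1.seq (h2.seq (h3.seq (h4.seq (h5.seq h6))))).mono ?_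
  have := a.size_pos
  have := b.size_pos
  omega

end StackProg

/-! ### Polynomial time functions on trees -/

namespace StackProg

open Polynomial

variable {N : ℕ}

theorem eval_mono (q : ℕ[X]) {m n : ℕ} (h : m ≤ n) : q.eval m ≤ q.eval n := by
  simp only [eval_eq_sum, Polynomial.sum]
  exact Finset.sum_le_sum fun i _ => Nat.mul_le_mul_left _ (Nat.pow_le_pow_left h i)

/-- The tree `v a` is computed from the tree `u a` in polynomial time, uniformly in `a`, by a
program acting on the top of the main stack. -/
def PFun (N : ℕ) {ι : Type*} (u v : ι → T) : Prop :=
  ∃ (p : Prog N) (q : ℕ[X]), ∀ a, (v a).size ≤ q.eval (u a).size ∧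
    ∀ io r, Ex p (st io ((u a).ser ++ r) [] [] []) (q.eval (u a).size)
      (st io ((v a).ser ++ r) [] [] [])

namespace PFun

variable {ι κ : Type*} {u v w : ι → T}

theorem id : PFun N u u :=
  ⟨.load _root_.id, X + 1, fun x => ⟨by simp, fun io r v => ⟨1, by simp, _, .load _ _ _⟩⟩⟩

/-- Working with families instead of functions on trees makes restriction to a subtype of indices
possible; this is how the branches of a case distinction are treated. -/
theorem pullback (h : PFun N u v) (φ : κ → ι) : PFun N (fun a => u (φ a)) fun a => v (φ a) := by
  obtain ⟨p, q, h⟩ := h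
  exact ⟨p, q, fun a => h (φ a)⟩

theorem comp (hf : PFun N v w) (hg : PFun N u v) : PFun N u w := by
  obtain ⟨p, q, h⟩ := hf
  obtain ⟨p', q', h'⟩ := hg
  refine ⟨.seq p' p, q' + q.comp q', fun x => ⟨?_, fun io r => ?_⟩⟩
  · rw [eval_add, eval_comp]
    exact ((h _).1.trans (eval_mono q (h' x).1)).trans (Nat.le_add_left _ _)
  · rw [eval_add, eval_comp]
    exact ((h' x).2 io r).seq (((h _).2 io r).mono (eval_mono q (h' x).1))

/-- In preorder, `cons a b` is a bit `true` followed by the two serializations. So once `f x` lies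
above `g x`, a single push forms the pair. -/
theorem pair {f g : ι → T} (hf : PFun N u f) (hg : PFun N u g) :
    PFun N u fun x => .cons (f x) (g x) := by
  obtain ⟨p, q, h⟩ := hf
  obtain ⟨p', q', h'⟩ := hg
  refine ⟨.seq dup (.seq p (.seq swap (.seq p' (.seq swap (.push .m fun _ => true))))),
    C 100 * (X + q + q' + 1), fun x => ⟨?_, fun io r => ?_⟩⟩
  · have h1 := (h x).1
    have h2 := (h' x).1
    simp only [T.size, eval_mul, eval_add, eval_C, eval_X, eval_one]
    omega
  · have h1 := (h x).1
    have h2 := (h' x).1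
    have key := (Ex.dup io (u x) r).seq (((h x).2 io ((u x).ser ++ r)).seq ((Ex.swap io (f x) (u x) r).seq
      (((h' x).2 io ((f x).ser ++ r)).seq ((Ex.swap io (g x) (f x) r).seq (Ex.push .m true _)))))
    simp only [bits_update_m, bits_m] at key
    simp only [T.ser, List.cons_append, List.append_assoc]
    refine key.mono ?_
    simp only [eval_mul, eval_add, eval_C, eval_X, eval_one]
    omega

theorem nil : PFun N u fun _ => .nil := by
  refine ⟨.seq drop (.push .m fun _ => false), C 20 * X + 1, fun x => ⟨?_, fun io r => ?_⟩⟩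
  · simp [T.size]
  · have key := (Ex.drop io (u x) r).seq (Ex.push .m false _)
    simp only [bits_update_m, bits_m] at key
    exact key.mono (by simp)

theorem const (a : T) : PFun N u fun _ => a := by
  induction a with
  | nil => exact nil
  | cons a b ha hb => exact ha.pair hb

/-- Branching on whether a computed tree is a leaf. -/
theorem ite {c : ι → T} (hc : PFun N u c)
    (hf : PFun N (fun a : {a // c a = .nil} => u a) fun a => v a)
    (hg : PFun N (fun a : {a // c a ≠ .nil} => u a) fun a => v a) : PFun N u v := by
  obtain ⟨p, q, h⟩ := hc
  obtain ⟨p₁, q₁, h₁⟩ := hf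
  obtain ⟨p₂, q₂, h₂⟩ := hg
  refine ⟨.seq dup (.seq p (.seq (popBit .m) (.ite (fun v => v.1 = some true)
    (.seq (.push .m fun _ => true) (.seq drop p₂)) (.seq (.push .m fun _ => false)
    (.seq drop p₁))))),
    C 40 * X + C 30 * q + q₁ + q₂ + C 10, fun x => ⟨?_, fun io r => ?_⟩⟩
  · simp only [eval_mul, eval_add, eval_C, eval_X]
    by_cases hx : c x = .nil
    · have := (h₁ ⟨x, hx⟩).1
      dsimp only at this
      omega
    · have := (h₂ ⟨x, hx⟩).1
      dsimp only at this
      omega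
  · have h0 := (h x).1
    refine Ex.mono ((Ex.dup io (u x) r).seq (((h x).2 io ((u x).ser ++ r)).seq
      (n' := 20 * (c x).size + q₁.eval (u x).size + q₂.eval (u x).size + 5) ?_)) ?_
    -- The top bit tells a leaf from a `cons`. Each branch pushes it back so that `drop` finds a
    -- complete tree.
    · rcases hx : c x with _ | ⟨a, b⟩
      · intro w
        have h5 := (Ex.pushMain false io ((u x).ser ++ r) [] [] []).seq
          ((Ex.drop io T.nil ((u x).ser ++ r)).seq ((h₁ ⟨x, hx⟩).2 io r))
        obtain ⟨k, hk, v', h6⟩ := h5 (some false, w.2)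
        refine ⟨_, ?_, v', .seq (.popMain w false _ _ _ _ _) (.ite_false (by simp) h6)⟩
        dsimp only at hk
        omega
      · intro w
        rw [T.ser_cons_append]
        have h5 := Ex.pushMain true io (a.ser ++ (b.ser ++ ((u x).ser ++ r))) [] [] []
        rw [← T.ser_cons_append] at h5
        obtain ⟨k, hk, v', h6⟩ := (h5.seq
          ((Ex.drop io (T.cons a b) ((u x).ser ++ r)).seq ((h₂ ⟨x, by simp [hx]⟩).2 io r)))
            (some true, w.2)
        refine ⟨_, ?_, v', .seq (.popMain w true _ _ _ _ _) (.ite_true (by simp) h6)⟩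
        dsimp only at hk
        omega
    · simp only [eval_mul, eval_add, eval_C, eval_X]
      omega

/-- Popping the root bit of a `cons` leaves its two subtrees stacked one above the other. -/
theorem left : PFun N u fun x => (u x).left := by
  refine ⟨.seq (popBit .m) (.ite (fun v => v.1 = some true) (.seq swap drop)
    (.push .m fun _ => false)), C 60 * X + C 5, fun x => ⟨?_, fun io r v => ?_⟩⟩
  · beta_reduce
    rcases u x with _ | ⟨a, b⟩ <;> simp only [T.left, T.size, eval_mul, eval_add, eval_C, eval_X] <;>
      omega
  · beta_reduce
    rcases u x with _ | ⟨a, b⟩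
    · obtain ⟨k, hk, v', h6⟩ := Ex.pushMain false io r [] [] [] (some false, v.2)
      refine ⟨_, ?_, v', .seq (.popMain v false _ _ _ _ _) (.ite_false (by simp) h6)⟩
      simp only [eval_mul, eval_add, eval_C, eval_X]; omega
    · rw [T.ser_cons_append]
      obtain ⟨k, hk, v', h6⟩ := ((Ex.swap io a b r).seq (Ex.drop io b _)) (some true, v.2)
      refine ⟨_, ?_, v', .seq (.popMain v true _ _ _ _ _) (.ite_true (by simp) h6)⟩
      simp only [eval_mul, eval_add, eval_C, eval_X, T.size]; omega

theorem right : PFun N u fun x => (u x).right := by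
  refine ⟨.seq (popBit .m) (.ite (fun v => v.1 = some true) drop
    (.push .m fun _ => false)), C 60 * X + C 5, fun x => ⟨?_, fun io r v => ?_⟩⟩
  · beta_reduce
    rcases u x with _ | ⟨a, b⟩ <;> simp only [T.right, T.size, eval_mul, eval_add, eval_C, eval_X] <;>
      omega
  · beta_reduce
    rcases u x with _ | ⟨a, b⟩
    · obtain ⟨k, hk, v', h6⟩ := Ex.pushMain false io r [] [] [] (some false, v.2)
      refine ⟨_, ?_, v', .seq (.popMain v false _ _ _ _ _) (.ite_false (by simp) h6)⟩
      simp only [eval_mul, eval_add, eval_C, eval_X]; omega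
    · rw [T.ser_cons_append]
      obtain ⟨k, hk, v', h6⟩ := (Ex.drop io a (b.ser ++ r)) (some true, v.2)
      refine ⟨_, ?_, v', .seq (.popMain v true _ _ _ _ _) (.ite_true (by simp) h6)⟩
      simp only [eval_mul, eval_add, eval_C, eval_X, T.size]; omega

/-- Bounded iteration: if each term of a sequence of trees is computed from the previous one, and
the terms stay polynomially bounded, then a number of steps given by the spine of a tree can be
performed in polynomial time. -/
theorem iterate {n : ι → T} {y : ι → ℕ → T}
    (hf : PFun N (fun a : ι × ℕ => y a.1 a.2) fun a => y a.1 (a.2 + 1))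
    (hn : PFun N u n) (hy : PFun N u fun a => y a 0) (B : ℕ[X])
    (hB : ∀ x i, i ≤ (n x).spine → (y x i).size ≤ B.eval (u x).size) :
    PFun N u fun x => y x (n x).spine := by
  obtain ⟨p, q, h⟩ := hf
  obtain ⟨p₀, q₀, h₀⟩ := hn.pair hy
  set body : Prog N := .seq drop (.seq swap (.seq p (.seq swap (popBit .m)))) with hbody
  -- Loop invariant: the root bit of the counter tree is in the register, the rest of that tree lies
  -- above the current term. A round drops the left subtree, advances the term and goes one step
  -- down the right spine. The number `M` bounds both the counter tree and all terms, hence the cost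
  -- of a round.
  have loop : ∀ (M : ℕ) (z : ι) (a : T) (j : ℕ) (io : List (Fin N)) (r : List Bool) (x : Fin N),
      a.size ≤ M → (∀ i, i ≤ a.spine → (y z (j + i)).size ≤ M) →
      ∃ k ≤ a.spine * (200 * M + q.eval M + 2) + 1, ∃ v',
        Run (.loop (fun v => v.1 = some true) body) (a.ser.head?, x)
          (st io (a.ser.tail ++ ((y z j).ser ++ r)) [] [] []) k v'
          (st io ((y z (j + a.spine)).ser ++ r) [] [] []) := by
    intro M z a
    induction a with
    | nil => exact fun j io r x _ _ => ⟨1, by simp, _, .loop_false (by simp [T.ser])⟩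
    | cons a a' _ ih =>
      intro j io r x ha hb
      simp only [T.size] at ha
      simp only [T.spine] at hb
      have hb0 := hb 0 (by omega)
      have hb1 := hb 1 (by omega)
      rw [add_zero] at hb0
      have h1 := (Ex.drop io a (a'.ser ++ ((y z j).ser ++ r))).seq ((Ex.swap io a' (y z j) r).seq
        (((h (z, j)).2 io (a'.ser ++ r)).seq (Ex.swap io (y z (j + 1)) a' r)))
      obtain ⟨k, hk, v', hr⟩ := h1 (some true, x)
      have h2 := Run.popBit .m v'.1 v'.2 io (bits (a'.ser ++ ((y z (j + 1)).ser ++ r)) [] [] [])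
      have ha' : ∀ s : List Bool, (a'.ser ++ s).head? = a'.ser.head? ∧
          (a'.ser ++ s).tail = a'.ser.tail ++ s := by
        intro s; cases a' <;> simp [T.ser]
      simp only [bits_update_m, bits_m, ha'] at h2
      obtain ⟨k', hk', v'', hr'⟩ := ih (j + 1) io r v'.2 (by omega)
        (fun i hi => by simpa [add_assoc, add_comm 1] using hb (i + 1) (by omega))
      have h3 : Run body (some true, x) (st io (a.ser ++ (a'.ser ++ ((y z j).ser ++ r))) [] [] []) (k + 1)
          (a'.ser.head?, v'.2) (st io (a'.ser.tail ++ ((y z (j + 1)).ser ++ r)) [] [] []) := by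
        rw [hbody]
        cases hr with
        | seq e1 hr =>
          cases hr with
          | seq e2 hr =>
            cases hr with
            | seq e3 hr =>
              exact (Run.seq e1 (.seq e2 (.seq e3 (.seq hr h2)))).of_eq (by omega) rfl
      rw [show (T.cons a a').ser.tail ++ ((y z j).ser ++ r) = a.ser ++ (a'.ser ++ ((y z j).ser ++ r)) by
        simp [T.ser]]
      refine ⟨_, ?_, v'', (Run.loop_true (by simp) h3 hr').of_eq rfl ?_⟩
      · dsimp only at hk
        have := eval_mono q hb0
        simp only [T.spine]
        rw [add_mul]
        omega
      · simp only [T.spine, add_assoc, add_comm 1]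
  -- The first pop removes the root of the pair of counter and initial term, the second loads the
  -- root bit of the counter. The loop is then used with `M` equal to the value of `q₀ + B`, which
  -- also bounds the number of rounds, as a spine is shorter than its tree.
  refine ⟨.seq p₀ (.seq (popBit .m) (.seq (popBit .m) (.loop (fun v => v.1 = some true) body))),
    q₀ + C 3 + (q₀ + B) * (C 200 * (q₀ + B) + q.comp (q₀ + B) + C 2) + B, fun x => ⟨?_, fun io r v => ?_⟩⟩
  · refine (hB x _ le_rfl).trans ?_
    rw [eval_add]
    exact Nat.le_add_left _ _
  · obtain ⟨k, hk, v₁, hr⟩ := (h₀ x).2 io r v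
    have hs := (h₀ x).1
    simp only [T.size] at hs
    have h1 := Run.popMain v₁ true io ((n x).ser ++ ((y x 0).ser ++ r)) [] [] []
    rw [← T.ser_cons_append] at h1
    have h2 := Run.popBit .m (some true) v₁.2 io (bits ((n x).ser ++ ((y x 0).ser ++ r)) [] [] [])
    have ha' : ∀ s : List Bool, ((n x).ser ++ s).head? = (n x).ser.head? ∧
        ((n x).ser ++ s).tail = (n x).ser.tail ++ s := by
      intro s; cases n x <;> simp [T.ser]
    simp only [bits_update_m, bits_m, ha'] at h2
    obtain ⟨k', hk', v', h3⟩ := loop (q₀.eval (u x).size + B.eval (u x).size) x (n x) 0 io r v₁.2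
      (by omega) (fun i hi => by rw [zero_add]; exact (hB x i hi).trans (Nat.le_add_left _ _))
    refine ⟨_, ?_, v', .seq hr (.seq h1 (.seq h2 (h3.of_eq rfl (by rw [zero_add]))))⟩
    simp only [eval_mul, eval_add, eval_C, eval_comp]
    have hsp := (n x).spine_lt_size
    have := Nat.mul_le_mul_right (200 * (q₀.eval (u x).size + B.eval (u x).size) +
      q.eval (q₀.eval (u x).size + B.eval (u x).size) + 2)
      (show (n x).spine ≤ q₀.eval (u x).size + B.eval (u x).size by omega)
    omega

end PFun

end StackProg

/-! ### From programs on trees to Turing machines -/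

namespace StackProg

open Polynomial Turing Turing.TM2 StateTransition

/-- Numerals as trees. -/
def T.num : ℕ → T
  | 0 => .nil
  | n + 1 => .cons .nil (T.num n)

/-- Lists of numerals as trees. -/
def T.ofList (l : List ℕ) : T := l.foldr (fun n t => .cons (T.num n) t) .nil

theorem T.size_num (n : ℕ) : (T.num n).size = 2 * n + 1 := by
  induction n with
  | zero => rfl
  | succ n ih => simp only [T.num, T.size, ih]; omega

theorem T.size_ofList {N : ℕ} {l : List ℕ} (h : ∀ n ∈ l, n < N) :
    (T.ofList l).size ≤ 2 * N * l.length + 1 := by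
  induction l with
  | nil => simp [T.ofList, T.size]
  | cons n l ih =>
    have h1 := ih fun x hx => h x (List.mem_cons_of_mem _ hx)
    have h2 := h n List.mem_cons_self
    have h3 : T.ofList (n :: l) = .cons (T.num n) (T.ofList l) := rfl
    rw [h3, T.size, T.size_num, List.length_cons, mul_add]
    omega

variable {N : ℕ} [NeZero N]

/-- Read a letter off the input. -/
def readLetter : Prog N := .read fun v o => (o.map fun _ => true, o.getD v.2)

/-- Add the letter in the register to the numeral on top of the main stack. -/
def pushNum : Prog N :=
  .loop (fun v => v.2 ≠ 0) (.seq (.push .m fun _ => false) (.seq (.push .m fun _ => true)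
    (.load fun v => (v.1, Fin.ofNat N (v.2 - 1)))))

/-- Pushing `false` and then `true` puts `cons nil` in front of the tree on top, which is the
successor on numerals. -/
theorem Run.pushNum (n : ℕ) : ∀ (j : ℕ) (b : Option Bool) (x : Fin N) (io : List (Fin N))
    (r : List Bool), (x : ℕ) = n → Run pushNum (b, x) (st io ((T.num j).ser ++ r) [] [] []) (4 * n + 1)
      (b, 0) (st io ((T.num (j + n)).ser ++ r) [] [] []) := by
  induction n with
  | zero =>
    intro j b x io r hx
    obtain rfl : x = 0 := Fin.ext (by simpa using hx)
    exact .loop_false (by simp)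
  | succ n ih =>
    intro j b x io r hx
    have hx0 : x ≠ 0 := by rintro rfl; simp at hx
    have hx1 : ((Fin.ofNat N (x - 1) : Fin N) : ℕ) = n := by
      have := x.isLt
      simp only [Fin.ofNat, hx]
      exact Nat.mod_eq_of_lt (by omega)
    have h1 : Run _ (b, x) (st io ((T.num j).ser ++ r) [] [] []) _ _ _ :=
      Run.seq (.push .m (fun _ => false) _ _) (.seq (.push .m (fun _ => true) _ _)
        (.load (fun v => (v.1, Fin.ofNat N (v.2 - 1))) _ _))
    have h2 := ih (j + 1) b (Fin.ofNat N (x - 1)) io r hx1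
    rw [show j + 1 + n = j + (n + 1) by omega] at h2
    have h3 : (T.num (j + 1)).ser ++ r = true :: false :: ((T.num j).ser ++ r) := by
      simp [T.num, T.ser]
    rw [h3] at h2
    simp only [bits_update_m, bits_m] at h1
    exact (Run.loop_true (by simpa using hx0) h1 h2).of_eq (by omega) rfl

/-- Convert the input to a tree on the main stack. -/
def inputProg : Prog N :=
  .seq (.push .m fun _ => false) (.seq readLetter (.loop (fun v => v.1.isSome)
    (.seq (.push .m fun _ => false) (.seq pushNum (.seq (.push .m fun _ => true) readLetter)))))

/-- Letters are consed to the list of those already read, so the input arrives reversed. -/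
theorem Ex.inputProg (io : List (Fin N)) :
    Ex inputProg (st io [] [] [] []) (io.length * (4 * N + 10) + 3)
      (st [] (T.ofList (io.map Fin.val).reverse).ser [] [] []) := by
  have key : ∀ (io : List (Fin N)) (l : List ℕ) (x : Fin N), ∃ k ≤ io.length * (4 * N + 10) + 1, ∃ v',
      Run (.loop (fun v => v.1.isSome)
        (.seq (.push .m fun _ => false) (.seq pushNum (.seq (.push .m fun _ => true) readLetter))))
      (io.head?.map fun _ => true, io.head?.getD x) (st io.tail (T.ofList l).ser [] [] []) k v'
      (st [] (T.ofList ((io.map Fin.val).reverse ++ l)).ser [] [] []) := by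
    intro io
    induction io with
    | nil => exact fun l x => ⟨1, by simp, _, .loop_false (by simp)⟩
    | cons y io ih =>
      intro l x
      obtain ⟨k, hk, v', h⟩ := ih (y :: l) 0
      have h1 := Run.push .m (fun _ => false) (some true, y) (st io (T.ofList l).ser [] [] [])
      have h2 := Run.pushNum y 0 (some true) y io (T.ofList l).ser rfl
      have h3 := Run.push .m (fun _ => true) (some true, 0)
        (st io ((T.num y).ser ++ (T.ofList l).ser) [] [] [])
      have h4 : Run readLetter (some true, 0) (st io (T.ofList (y :: l)).ser [] [] []) 1 _ _ :=
        Run.read _ _ _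
      simp only [bits_update_m, bits_m] at h1 h3
      rw [Nat.zero_add] at h2
      refine ⟨_, ?_, v', (Run.loop_true (by simp) (h1.seq (h2.seq (h3.seq h4))) h).of_eq rfl ?_⟩
      · have := y.isLt
        rw [List.length_cons, add_mul]
        omega
      · simp
  intro v
  obtain ⟨k, hk, v', h⟩ := key io [] v.2
  have h1 := Run.push .m (fun _ => false) v (st io [] [] [] [])
  have h2 : Run readLetter v (st io [false] [] [] []) 1 _ _ := Run.read _ _ _
  simp only [bits_update_m, bits_m] at h1
  rw [List.append_nil] at h
  exact ⟨_, by omega, v', h1.seq (h2.seq h)⟩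

/-- Read a numeral off the main stack into the register, its first bit having been read. -/
def popNum : Prog N :=
  .loop (fun v => v.1 = some true)
    (.seq (popBit .m) (.seq (.load fun v => (v.1, Fin.ofNat N (v.2 + 1))) (popBit .m)))

theorem T.ser_num_append (n : ℕ) (r : List Bool) :
    (T.num n).ser ++ r = decide (n ≠ 0) :: ((T.num n).ser.tail ++ r) := by
  cases n <;> simp [T.num, T.ser]

theorem Run.popNum (n : ℕ) : ∀ (x : Fin N) (io : List (Fin N)) (r : List Bool) (hn : (x : ℕ) + n < N),
    Run popNum (some (decide (n ≠ 0)), x) (st io ((T.num n).ser.tail ++ r) [] [] []) (4 * n + 1)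
      (some false, ⟨x + n, hn⟩) (st io r [] [] []) := by
  induction n with
  | zero => exact fun x io r hn => .loop_false (by simp)
  | succ n ih =>
    intro x io r hn
    have hx : ((Fin.ofNat N (x + 1) : Fin N) : ℕ) = x + 1 := by
      simp only [Fin.ofNat]
      exact Nat.mod_eq_of_lt (by omega)
    have h1 := Run.popMain (some true, x) false io ((T.num n).ser ++ r) [] [] []
    have h2 := Run.load (fun v : Reg N => (v.1, Fin.ofNat N (v.2 + 1))) (some false, x)
      (st io ((T.num n).ser ++ r) [] [] [])
    have h3 := Run.popMain (some false, Fin.ofNat N (x + 1)) (decide (n ≠ 0)) io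
      ((T.num n).ser.tail ++ r) [] [] []
    rw [← T.ser_num_append] at h3
    have h4 := ih (Fin.ofNat N (x + 1)) io r (by omega)
    have h5 := Run.loop_true (f := fun v : Reg N => v.1 = some true) (by simp)
      (h1.seq (h2.seq h3)) h4
    have h6 : (⟨x + (n + 1), hn⟩ : Fin N) = ⟨(Fin.ofNat N (x + 1) : Fin N) + n, by omega⟩ :=
      Fin.ext (by simp only [hx]; omega)
    rw [h6]
    simp only [ne_eq, Nat.add_eq_zero_iff, one_ne_zero, and_false, not_false_eq_true, decide_true]
    exact h5.of_eq (by omega) rfl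

/-- Convert the tree on the main stack to the output. -/
def outputProg : Prog N :=
  .seq (popBit .m) (.seq (.loop (fun v => v.1 = some true)
    (.seq (.load fun v => (v.1, 0)) (.seq (popBit .m) (.seq popNum
      (.seq (.write fun v => v.2) (popBit .m)))))) (.load fun _ => (none, 0)))

/-- Writing to a stack reverses the list. The final register is specified, unlike in `Ex`, because a
halting configuration in the sense of `haltList` has to be back in the initial internal state; the
last `load` sees to that. -/
theorem outputProg_run (l : List (Fin N)) (v : Reg N) :
    ∃ k ≤ l.length * (4 * N + 10) + 3, Run outputProg v
      (st [] (T.ofList (l.map Fin.val)).ser [] [] []) k (none, 0) (st l.reverse [] [] [] []) := by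
  have hne : ∀ l : List (Fin N), (T.ofList (l.map Fin.val)).ser =
      decide (l ≠ []) :: (T.ofList (l.map Fin.val)).ser.tail := by
    intro l; cases l <;> simp [T.ofList, T.ser]
  have key : ∀ (l io : List (Fin N)) (x : Fin N), ∃ k ≤ l.length * (4 * N + 10) + 1, ∃ v',
      Run (.loop (fun v => v.1 = some true)
        (.seq (.load fun v => (v.1, 0)) (.seq (popBit .m) (.seq popNum
        (.seq (.write fun v => v.2) (popBit .m))))))
      (some (decide (l ≠ [])), x) (st io (T.ofList (l.map Fin.val)).ser.tail [] [] []) k v'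
      (st (l.reverse ++ io) [] [] [] []) := by
    intro l
    induction l with
    | nil => exact fun io x => ⟨1, by simp, _, (Run.loop_false (by simp)).of_eq rfl (by
        simp [T.ofList, T.ser])⟩
    | cons y l ih =>
      intro io x
      obtain ⟨k, hk, v', h⟩ := ih (y :: io) y
      have h1 := Run.load (fun v : Reg N => (v.1, 0)) (some true, x)
        (st io ((T.num y).ser ++ (T.ofList (l.map Fin.val)).ser) [] [] [])
      have h2 := Run.popMain (some true, 0) (decide ((y : ℕ) ≠ 0)) io
        ((T.num y).ser.tail ++ (T.ofList (l.map Fin.val)).ser) [] [] []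
      have h3 := Run.popNum y 0 io (T.ofList (l.map Fin.val)).ser (by simp)
      have h4 := Run.write (fun v : Reg N => v.2) (some false, y)
        (st io (T.ofList (l.map Fin.val)).ser [] [] [])
      have h5 := Run.popMain (some false, y) (decide (l ≠ [])) (y :: io)
        (T.ofList (l.map Fin.val)).ser.tail [] [] []
      rw [← T.ser_num_append] at h2
      rw [← hne] at h5
      simp only [Fin.val_zero, zero_add, Fin.eta] at h3
      have h6 : (T.ofList ((y :: l).map Fin.val)).ser.tail =
          (T.num y).ser ++ (T.ofList (l.map Fin.val)).ser := by simp [T.ofList, T.ser]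
      rw [h6]
      refine ⟨_, ?_, v', (Run.loop_true (by simp)
        (h1.seq (h2.seq (h3.seq (h4.seq h5)))) h).of_eq rfl ?_⟩
      · have := y.isLt
        rw [List.length_cons, add_mul]
        omega
      · simp
  obtain ⟨k, hk, v', h⟩ := key l [] v.2
  have h1 := Run.popMain v (decide (l ≠ [])) [] (T.ofList (l.map Fin.val)).ser.tail [] [] []
  rw [← hne] at h1
  rw [List.append_nil] at h
  exact ⟨_, by omega, h1.seq (h.seq (.load _ _ _))⟩

/-- The Turing machine that runs a program. -/
noncomputable def Prog.toFinTM2 (p : Prog N) : FinTM2 :=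
  haveI := p.finite_lab
  { K := Option Aux
    k₀ := none
    k₁ := none
    Γ := Alph N
    Λ := Option p.Lab
    main := some p.entry
    ΛFin := Fintype.ofFinite _
    σ := Reg N
    initialState := (none, 0)
    Γk₀Fin := inferInstanceAs (Fintype (Fin N))
    m := p.machine }

/-- A function is computable in polynomial time by a Turing machine if it is, up to the encoding of
letters by numerals, a polynomial time function on trees. -/
theorem PFun.computable {α β A : Type} (e : A ≃ Fin N)
    (ea : α → List A) (eb : β → List A) (f : α → β)
    (hf : PFun N (fun a => T.ofList ((ea a).map fun x => (e x : ℕ)).reverse) fun a =>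
      T.ofList ((eb (f a)).map fun x => (e x : ℕ)).reverse) :
    Nonempty (TM2ComputableInPolyTime ea eb f) := by
  obtain ⟨p, q, h⟩ := hf
  let P : Prog N := .seq inputProg (.seq p outputProg)
  let tm : FinTM2 := P.toFinTM2
  -- An input of length `n` becomes a tree of size at most `2 * N * n + 1`. The summands are the
  -- costs of reading the input, of `p`, of writing the output, and of the halting step.
  let Q : ℕ[X] := X * C (4 * N + 10) + C 3 + (q.comp (C (2 * N) * X + C 1) +
    (q.comp (C (2 * N) * X + C 1) * C (4 * N + 10) + C 3)) + C 1
  have hlen : ∀ l : List ℕ, l.length ≤ (T.ofList l).size := by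
    intro l
    induction l with
    | nil => simp
    | cons x l ih =>
      have : T.ofList (x :: l) = .cons (T.num x) (T.ofList l) := rfl
      rw [this, T.size, List.length_cons]
      omega
  have main : ∀ a, ∃ k ≤ Q.eval (ea a).length, Reach P.machine
      ⟨some (some P.entry), (none, 0), (st ((ea a).map e) [] [] [] []).stk⟩ k
      ⟨none, (none, 0), (st ((eb (f a)).map e) [] [] [] []).stk⟩ := by
    intro a
    obtain ⟨k₁, hk₁, v₁, h₁⟩ := Ex.inputProg ((ea a).map e) (none, 0)
    rw [List.map_map, show Fin.val ∘ e = fun x => (e x : ℕ) from rfl] at h₁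
    have hsz : (T.ofList ((ea a).map fun x => (e x : ℕ)).reverse).size ≤ 2 * N * (ea a).length + 1 := by
      refine (T.size_ofList (N := N) ?_).trans (by simp)
      intro n hn
      simp only [List.mem_reverse, List.mem_map] at hn
      obtain ⟨x, -, rfl⟩ := hn
      exact (e x).isLt
    obtain ⟨hs, hp⟩ := h a
    have hs' := hs.trans (eval_mono q hsz)
    obtain ⟨k₂, hk₂, v₂, h₂⟩ := hp [] [] v₁
    have hk₂' := hk₂.trans (eval_mono q hsz)
    obtain ⟨k₃, hk₃, h₃⟩ := outputProg_run ((eb (f a)).map e).reverse v₂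
    rw [List.map_reverse, List.map_map, show Fin.val ∘ e = fun x => (e x : ℕ) from rfl,
      List.reverse_reverse] at h₃
    simp only [List.append_nil] at h₂
    refine ⟨_, ?_, (h₁.seq (h₂.seq h₃)).reach_halt⟩
    have hl := (hlen _).trans hs'
    rw [List.length_reverse, List.length_map] at hl
    rw [List.length_reverse, List.length_map] at hk₃
    rw [List.length_map] at hk₁
    have := Nat.mul_le_mul_right (4 * N + 10) hl
    simp only [Q, eval_add, eval_mul, eval_C, eval_X, eval_comp]
    omega
  have hinit : ∀ s : List (Fin N), initList tm s =
      ⟨some (some P.entry), (none, 0), (st s [] [] [] []).stk⟩ := by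
    intro s
    refine congrArg (Cfg.mk (some (some P.entry)) ((none, 0) : Reg N)) ?_
    funext k
    rcases k with _ | _ | _ | _ | _ <;> rfl
  have hhalt : ∀ s : List (Fin N), haltList tm s =
      ⟨none, (none, 0), (st s [] [] [] []).stk⟩ := by
    intro s
    refine congrArg (Cfg.mk none ((none, 0) : Reg N)) ?_
    funext k
    rcases k with _ | _ | _ | _ | _ <;> rfl
  choose k hk hr using main
  exact ⟨{
    tm := tm
    inputAlphabet := e.symm
    outputAlphabet := e.symm
    time := Q
    outputsFun := fun a =>
      { steps := k a
        evals_in_steps :=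
          (congrArg (fun c : tm.Cfg => (flip bind tm.step)^[k a] (some c)) (hinit _)).trans
            (Eq.trans (hr a) (congrArg some (hhalt _).symm))
        steps_le_m := hk a } }⟩

end StackProg

/-! ### Polynomial time functions on encoded types -/

namespace StackProg

open Polynomial

/-- Types whose elements are encoded by trees. -/
class TreeEnc (α : Type) where
  enc : α → T

open TreeEnc (enc)

instance : TreeEnc ℕ := ⟨T.num⟩
instance {n : ℕ} : TreeEnc (Fin n) := ⟨fun i => T.num i⟩
instance : TreeEnc Bool := ⟨fun b => bif b then .cons .nil .nil else .nil⟩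
instance {α β : Type} [TreeEnc α] [TreeEnc β] : TreeEnc (α × β) :=
  ⟨fun p => .cons (enc p.1) (enc p.2)⟩
instance {α : Type} [TreeEnc α] : TreeEnc (Option α) :=
  ⟨fun o => o.elim .nil fun a => .cons (enc a) .nil⟩
instance {α : Type} [TreeEnc α] : TreeEnc (List α) :=
  ⟨fun l => l.foldr (fun a t => .cons (enc a) t) .nil⟩

/-- The size of the encoding. -/
def sz {α : Type} [TreeEnc α] (a : α) : ℕ := (enc a).size

section sz

variable {α β : Type} [TreeEnc α] [TreeEnc β]

theorem enc_cons (a : α) (l : List α) : enc (a :: l) = .cons (enc a) (enc l) := rfl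
theorem enc_nil : enc ([] : List α) = .nil := rfl
theorem sz_pair (a : α) (b : β) : sz (a, b) = sz a + sz b + 1 := rfl
theorem sz_nil : sz ([] : List α) = 1 := rfl
theorem sz_cons (a : α) (l : List α) : sz (a :: l) = sz a + sz l + 1 := rfl
theorem sz_none : sz (none : Option α) = 1 := rfl
theorem sz_some (a : α) : sz (some a) = sz a + 2 := rfl
theorem sz_nat (n : ℕ) : sz n = 2 * n + 1 := T.size_num n
theorem sz_fin {n : ℕ} (i : Fin n) : sz i = 2 * (i : ℕ) + 1 := T.size_num i
theorem sz_bool (b : Bool) : sz b ≤ 3 := by cases b <;> simp [sz, enc, T.size]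

theorem sz_mem {a : α} {l : List α} (h : a ∈ l) : sz a ≤ sz l := by
  induction l with
  | nil => simp at h
  | cons b l ih =>
    rw [sz_cons]
    rcases List.mem_cons.1 h with rfl | h
    · omega
    · have := ih h; omega

theorem length_le_sz (l : List α) : l.length ≤ sz l := by
  induction l with
  | nil => simp
  | cons b l ih => rw [sz_cons, List.length_cons]; omega

theorem sz_drop_le (l : List α) (i : ℕ) : sz (l.drop i) ≤ sz l := by
  induction l generalizing i with
  | nil => simp
  | cons b l ih =>
    cases i with
    | zero => simp
    | succ i => rw [sz_cons, List.drop_succ_cons]; have := ih i; omega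

theorem sz_le_of_forall {l : List α} {B : ℕ} (h : ∀ a ∈ l, sz a ≤ B) :
    sz l ≤ l.length * (B + 1) + 1 := by
  induction l with
  | nil => simp [sz_nil]
  | cons b l ih =>
    rw [sz_cons, List.length_cons, add_mul]
    have h1 := ih fun a ha => h a (List.mem_cons_of_mem _ ha)
    have h2 := h b List.mem_cons_self
    omega

theorem spine_enc_list (l : List α) : (enc l).spine = l.length := by
  induction l with
  | nil => rfl
  | cons a l ih => rw [enc_cons, T.spine, ih, List.length_cons]

end sz

/-- The function `f` is computed in polynomial time by a program. -/
def PT (N : ℕ) {α β : Type} [TreeEnc α] [TreeEnc β] (f : α → β) : Prop :=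
  PFun N (fun a => enc a) fun a => enc (f a)

namespace PT

variable {N : ℕ} {α β γ δ : Type} [TreeEnc α] [TreeEnc β] [TreeEnc γ] [TreeEnc δ]

theorem size_le {f : α → β} (hf : PT N f) : ∃ q : ℕ[X], ∀ a, sz (f a) ≤ q.eval (sz a) := by
  obtain ⟨p, q, h⟩ := hf
  exact ⟨q, fun a => (h a).1⟩

theorem id : PT N fun a : α => a := PFun.id

theorem comp {f : β → γ} {g : α → β} (hf : PT N f) (hg : PT N g) : PT N fun a => f (g a) :=
  PFun.comp (hf.pullback g) hg

theorem pair {f : α → β} {g : α → γ} (hf : PT N f) (hg : PT N g) : PT N fun a => (f a, g a) :=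
  PFun.pair hf hg

theorem fst {f : α → β × γ} (hf : PT N f) : PT N fun a => (f a).1 := PFun.comp PFun.left hf

theorem snd {f : α → β × γ} (hf : PT N f) : PT N fun a => (f a).2 := PFun.comp PFun.right hf

theorem const (b : β) : PT N fun _ : α => b := PFun.const (enc b)

theorem comp₂ {f : β × γ → δ} {g : α → β} {h : α → γ} (hf : PT N f) (hg : PT N g) (hh : PT N h) :
    PT N fun a => f (g a, h a) := hf.comp (hg.pair hh)

theorem some {f : α → β} (hf : PT N f) : PT N fun a => some (f a) := PFun.pair hf PFun.nil

theorem cons {f : α → β} {g : α → List β} (hf : PT N f) (hg : PT N g) : PT N fun a => f a :: g a :=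
  PFun.pair hf hg

theorem cond {c : α → Bool} {f g : α → β} (hc : PT N c) (hf : PT N f) (hg : PT N g) :
    PT N fun a => bif c a then f a else g a := by
  refine PFun.ite hc ?_ ?_
  · convert hg.pullback (fun a : {a // enc (c a) = .nil} => a.1) using 2 with a
    obtain ⟨a, ha⟩ := a
    cases h : c a
    · simp [h]
    · simp [h, enc] at ha
  · convert hf.pullback (fun a : {a // enc (c a) ≠ .nil} => a.1) using 2 with a
    obtain ⟨a, ha⟩ := a
    cases h : c a
    · simp [h, enc] at ha
    · simp [h]

/-- On the subtype of indices with `o a ≠ none` the value of `o a` is defined and is the left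
subtree of the encoding, so `g` can be applied there. -/
theorem elim {o : α → Option β} {f : α → γ} {g : α × β → γ} (ho : PT N o) (hf : PT N f)
    (hg : PT N g) : PT N fun a => (o a).elim (f a) fun b => g (a, b) := by
  refine PFun.ite ho ?_ ?_
  · convert hf.pullback (fun a : {a // enc (o a) = .nil} => a.1) using 2 with a
    obtain ⟨a, ha⟩ := a
    cases h : o a
    · simp [h]
    · simp [h, enc] at ha
  · have hs : ∀ a : {a // enc (o a) ≠ .nil}, ∃ b, o a = Option.some b := by
      rintro ⟨a, ha⟩
      cases h : o a
      · simp [h, enc] at ha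
      · exact ⟨_, rfl⟩
    choose b hb using hs
    have h1 := hg.pullback (fun a : {a // enc (o a) ≠ .nil} => ((a : α), b a))
    have h2 : PFun N (fun a : {a // enc (o a) ≠ .nil} => enc (a : α)) fun a => enc ((a : α), b a) := by
      refine PFun.pair PFun.id ?_
      have h3 : PFun N (fun a : {a // enc (o a) ≠ .nil} => enc (a : α)) fun a => enc (o a) :=
        ho.pullback _
      convert PFun.comp PFun.left h3 using 2 with a
      rw [hb]; rfl
    convert h1.comp h2 using 2 with a
    dsimp only
    rw [hb]; rfl

theorem head? {f : α → List β} (hf : PT N f) : PT N fun a => (f a).head? := by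
  refine PFun.ite hf ?_ ?_
  · convert PFun.nil using 2 with a
    obtain ⟨a, ha⟩ := a
    cases h : f a
    · simp [h, enc]
    · simp [h, enc] at ha
  · have h1 : PFun N (fun a : {a // enc (f a) ≠ .nil} => enc (a : α)) fun a => enc (f a) :=
        hf.pullback _
    convert PFun.pair (PFun.comp PFun.left h1) PFun.nil using 2 with a
    obtain ⟨a, ha⟩ := a
    cases h : f a
    · simp [h, enc] at ha
    · simp only [h, enc_cons, T.left]; rfl

/-- Case distinction over a finite range. -/
theorem finCases {n : ℕ} {g : α → Fin n} {F : Fin n → α → β} (hg : PT N g) (hF : ∀ i, PT N (F i)) :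
    PT N fun a => F (g a) a := by
  -- The selector is a number, and the index type is arbitrary, so that the induction can split off
  -- the case 0 and continue with the predecessor on the remaining indices.
  have key : ∀ (n : ℕ) (κ : Type) (u : κ → T) (c : κ → ℕ) (G : ℕ → κ → T), (∀ a, c a < n) →
      PFun N u (fun a => T.num (c a)) → (∀ i < n, PFun N u (G i)) → PFun N u fun a => G (c a) a := by
    intro n
    induction n with
    | zero => exact fun κ u c G hc _ _ => ⟨.load _root_.id, 0, fun a => absurd (hc a) (by simp)⟩
    | succ n ih =>
      intro κ u c G hc hcu hG
      refine PFun.ite hcu ?_ ?_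
      · convert (hG 0 (by omega)).pullback (fun a : {a // T.num (c a) = .nil} => a.1) using 2 with a
        obtain ⟨a, ha⟩ := a
        cases h : c a
        · rfl
        · simp [h, T.num] at ha
      · have hpos : ∀ a : {a // T.num (c a) ≠ .nil}, c a = c a - 1 + 1 := by
          rintro ⟨a, ha⟩
          cases h : c a
          · simp [h, T.num] at ha
          · rfl
        have := ih {a // T.num (c a) ≠ .nil} (fun a => u a) (fun a => c a - 1) (fun i a => G (i + 1) a)
          (fun a => by have := hc a; have := hpos a; omega) (by
            have h1 : PFun N (fun a : {a // T.num (c a) ≠ .nil} => u a) fun a => T.num (c a) :=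
              hcu.pullback _
            convert PFun.comp PFun.right h1 using 2 with a
            rw [hpos a]; rfl)
          (fun i hi => (hG (i + 1) (by omega)).pullback _)
        convert this using 2 with a
        rw [← hpos a]
  have := key n α enc (fun a => g a) (fun i a => if h : i < n then enc (F ⟨i, h⟩ a) else .nil)
    (fun a => (g a).isLt) hg fun i hi => by
      simp only [dif_pos hi]; exact hF ⟨i, hi⟩
  simp only [Fin.is_lt, dif_pos, Fin.eta] at this
  exact this

/-- Bounded recursion on lists. -/
theorem foldl {l : α → List γ} {y : α → β} {f : α × β × γ → β} (hl : PT N l) (hy : PT N y)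
    (hf : PT N f) (B : ℕ[X])
    (hB : ∀ a i, sz (((l a).take i).foldl (fun b c => f (a, b, c)) (y a)) ≤ B.eval (sz a)) :
    PT N fun a => (l a).foldl (fun b c => f (a, b, c)) (y a) := by
  obtain ⟨ql, hql⟩ := hl.size_le
  -- The state after `i` rounds: the parameter, the unread part of the list, and the accumulator.
  let Y : α → ℕ → T := fun a i =>
    enc (a, (l a).drop i, ((l a).take i).foldl (fun b c => f (a, b, c)) (y a))
  have step : PFun N (fun a : α × ℕ => Y a.1 a.2) fun a => Y a.1 (a.2 + 1) := by
    -- The step must be computed for every `i`, so beyond the end of the list it leaves the state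
    -- unchanged.
    refine PFun.ite (c := fun a => enc ((l a.1).drop a.2)) (PFun.comp PFun.left
      (PFun.comp PFun.right PFun.id)) ?_ ?_
    · convert PFun.id using 2 with a
      obtain ⟨⟨a, i⟩, ha⟩ := a
      have h1 : (l a).length ≤ i := by
        rw [← List.drop_eq_nil_iff]
        rcases h : (l a).drop i with _ | ⟨c, l'⟩
        · rfl
        · simp only [h, enc_cons] at ha; exact absurd ha (by simp)
      simp only [Y]
      rw [List.drop_of_length_le h1, List.take_of_length_le h1, List.drop_of_length_le (by omega),
        List.take_of_length_le (by omega)]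
    · have hlt : ∀ a : {a : α × ℕ // enc ((l a.1).drop a.2) ≠ .nil}, a.1.2 < (l a.1.1).length := by
        rintro ⟨⟨a, i⟩, ha⟩
        by_contra h
        exact ha (by simp only [List.drop_of_length_le (not_lt.1 h), enc_nil])
      let φ : {a : α × ℕ // enc ((l a.1).drop a.2) ≠ .nil} → α × β × γ := fun a =>
        (a.1.1, ((l a.1.1).take a.1.2).foldl (fun b c => f (a.1.1, b, c)) (y a.1.1),
          (l a.1.1)[a.1.2]'(hlt a))
      have hd : ∀ a : {a : α × ℕ // enc ((l a.1).drop a.2) ≠ .nil}, (l a.1.1).drop a.1.2 =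
          (l a.1.1)[a.1.2]'(hlt a) :: (l a.1.1).drop (a.1.2 + 1) := fun a =>
        List.drop_eq_getElem_cons (hlt a)
      have hdr : PFun N (fun a : {a : α × ℕ // enc ((l a.1).drop a.2) ≠ .nil} => Y a.1.1 a.1.2)
          fun a => .cons (enc ((l a.1.1)[a.1.2]'(hlt a))) (enc ((l a.1.1).drop (a.1.2 + 1))) := by
        convert PFun.comp PFun.left (PFun.comp PFun.right PFun.id) using 2 with a
        rw [← enc_cons, ← hd a]; rfl
      have hac : PFun N (fun a : {a : α × ℕ // enc ((l a.1).drop a.2) ≠ .nil} => Y a.1.1 a.1.2)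
          fun a => enc (((l a.1.1).take a.1.2).foldl (fun b c => f (a.1.1, b, c)) (y a.1.1)) :=
        PFun.comp PFun.right (PFun.comp PFun.right PFun.id)
      have ha : PFun N (fun a : {a : α × ℕ // enc ((l a.1).drop a.2) ≠ .nil} => Y a.1.1 a.1.2)
          fun a => enc a.1.1 := PFun.comp PFun.left PFun.id
      have h1 := (hf.pullback φ).comp (PFun.pair ha (PFun.pair hac (PFun.comp PFun.left hdr)))
      convert PFun.pair ha (PFun.pair (PFun.comp PFun.right hdr) h1) using 2 with a
      simp only [Y]
      rw [List.take_succ_eq_append_getElem (hlt a), List.foldl_append]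
      rfl
  have init : PFun N (fun a => enc a) fun a => Y a 0 := by
    simp only [Y, List.drop_zero, List.take_zero, List.foldl_nil]
    exact PFun.pair PFun.id (PFun.pair hl hy)
  have fin := PFun.iterate step hl init (X + ql + B + C 2) fun a i _ => by
    have h1 := hB a i
    have h2 := (sz_drop_le (l a) i).trans (hql a)
    simp only [eval_add, eval_X, eval_C]
    change sz (a, (l a).drop i, ((l a).take i).foldl (fun b c => f (a, b, c)) (y a)) ≤ _
    rw [sz_pair, sz_pair]
    change sz a + _ + _ ≤ sz a + ql.eval (sz a) + B.eval (sz a) + 2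
    omega
  have fin' := PFun.comp PFun.right (PFun.comp PFun.right fin)
  convert fin' using 2 with a
  simp only [spine_enc_list, Y, List.take_length]
  rfl

/-- Bounded recursion on lists, where each step enlarges the result by a bounded amount. -/
theorem foldl_of_le {l : α → List γ} {y : α → β} {f : α × β × γ → β} (hl : PT N l) (hy : PT N y)
    (hf : PT N f) (A : ℕ[X]) (hA : ∀ a b, ∀ c ∈ l a, sz (f (a, b, c)) ≤ sz b + A.eval (sz a)) :
    PT N fun a => (l a).foldl (fun b c => f (a, b, c)) (y a) := by
  obtain ⟨ql, hql⟩ := hl.size_le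
  obtain ⟨qy, hqy⟩ := hy.size_le
  refine foldl hl hy hf (qy + ql * A) fun a i => ?_
  have key : ∀ (l' : List γ) (b : β), (∀ c ∈ l', c ∈ l a) →
      sz (l'.foldl (fun b c => f (a, b, c)) b) ≤ sz b + l'.length * A.eval (sz a) := by
    intro l'
    induction l' with
    | nil => simp
    | cons c l' ih =>
      intro b hc
      have h1 := ih (f (a, b, c)) fun c' hc' => hc c' (List.mem_cons_of_mem _ hc')
      have h2 := hA a b c (hc c List.mem_cons_self)
      rw [List.foldl_cons, List.length_cons, add_mul]
      omega
  refine (key _ _ fun c hc => List.mem_of_mem_take hc).trans ?_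
  have h1 : ((l a).take i).length ≤ ql.eval (sz a) :=
    ((List.length_take_le' _ _).trans (length_le_sz _)).trans (hql a)
  have h2 := Nat.mul_le_mul_right (A.eval (sz a)) h1
  have h3 := hqy a
  rw [eval_add, eval_mul]
  omega

theorem reverse {l : α → List γ} (hl : PT N l) : PT N fun a => (l a).reverse := by
  obtain ⟨ql, hql⟩ := hl.size_le
  have := foldl_of_le (f := fun p : α × List γ × γ => p.2.2 :: p.2.1) hl (const [])
    (cons id.snd.snd id.snd.fst) (ql + C 1) fun a b c hc => by
      have := (sz_mem hc).trans (hql a)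
      simp only [sz_cons, eval_add, eval_C]
      omega
  simpa using this

theorem filterMap {l : α → List γ} {f : α × γ → Option β} (hl : PT N l) (hf : PT N f) :
    PT N fun a => (l a).filterMap fun c => f (a, c) := by
  obtain ⟨ql, hql⟩ := hl.size_le
  obtain ⟨qf, hqf⟩ := hf.size_le
  have h1 := foldl_of_le
    (f := fun p : α × List β × γ => (f (p.1, p.2.2)).elim p.2.1 fun b => b :: p.2.1) hl (const [])
    (elim (hf.comp₂ id.fst id.snd.snd) id.snd.fst (cons id.snd id.fst.snd.fst))
    (qf.comp (X + ql + C 1) + C 1) fun a b c hc => by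
      have h2 := (sz_mem hc).trans (hql a)
      have h3 := (hqf (a, c)).trans (eval_mono qf (show sz (a, c) ≤ (X + ql + C 1).eval (sz a) by
        rw [sz_pair, eval_add, eval_add, eval_X, eval_C]; omega))
      simp only [eval_add, eval_C, eval_comp]
      simp only [eval_add, eval_C, eval_X] at h3 ⊢
      cases h : f (a, c) with
      | none => simp only [Option.elim_none]; omega
      | some d =>
        rw [h, sz_some] at h3
        simp only [Option.elim_some, sz_cons]
        omega
  convert h1.reverse using 2 with a
  have key : ∀ (l' : List γ) (acc : List β), (l'.foldl
      (fun b c => (f (a, c)).elim b fun d => d :: b) acc) =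
      (l'.filterMap fun c => f (a, c)).reverse ++ acc := by
    intro l'
    induction l' with
    | nil => simp
    | cons c l' ih =>
      intro acc
      rw [List.foldl_cons, ih, List.filterMap_cons]
      cases h : f (a, c) <;> simp
  simp [key]

theorem map {l : α → List γ} {f : α × γ → β} (hl : PT N l) (hf : PT N f) :
    PT N fun a => (l a).map fun c => f (a, c) := by
  have := filterMap hl hf.some
  simpa only [List.filterMap_eq_map'] using this

theorem succ {f : α → ℕ} (hf : PT N f) : PT N fun a => f a + 1 := PFun.pair PFun.nil hf

theorem pred {f : α → ℕ} (hf : PT N f) : PT N fun a => f a - 1 := by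
  have h : PFun N (fun a => enc a) fun a => (enc (f a)).right := PFun.comp PFun.right hf
  have h' : (fun a => enc (f a - 1)) = fun a => (enc (f a)).right := by
    funext a
    cases f a <;> rfl
  unfold PT
  rwa [h']

theorem isZero {f : α → ℕ} (hf : PT N f) : PT N fun a => decide (f a = 0) := by
  refine PFun.ite hf ?_ ?_
  · convert PFun.const (.cons .nil .nil) using 2 with a
    obtain ⟨a, ha⟩ := a
    cases h : f a
    · simp [h, enc]
    · simp [h, enc, T.num] at ha
  · convert PFun.nil using 2 with a
    obtain ⟨a, ha⟩ := a
    cases h : f a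
    · simp [h, enc, T.num] at ha
    · simp [h, enc]

/-- A numeral is, as a tree, a list of that many copies of `false`. Hence one can fold over it and
take predecessors `g a` times. -/
theorem sub {f g : α → ℕ} (hf : PT N f) (hg : PT N g) : PT N fun a => f a - g a := by
  have hg' : PT N fun a => List.replicate (g a) false := by
    have h : (fun a => enc (List.replicate (g a) false)) = fun a => enc (g a) := by
      funext a
      change _ = T.num (g a)
      generalize g a = n
      induction n with
      | zero => rfl
      | succ n ih => rw [List.replicate_succ, enc_cons, ih]; rfl
    unfold PT
    rw [h]
    exact hg
  have key : ∀ n m : ℕ, (List.replicate n false).foldl (fun b _ => b - 1) m = m - n := by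
    intro n
    induction n with
    | zero => simp
    | succ n ih => intro m; rw [List.replicate_succ, List.foldl_cons, ih]; omega
  have := foldl_of_le (f := fun p : α × ℕ × Bool => p.2.1 - 1) hg' hf id.snd.fst.pred 0
    fun a b c _ => by simp only [sz_nat]; omega
  simpa only [key] using this

theorem lt {f g : α → ℕ} (hf : PT N f) (hg : PT N g) : PT N fun a => decide (f a < g a) := by
  convert isZero ((hf.succ).sub hg) using 4
  omega

theorem and {f g : α → Bool} (hf : PT N f) (hg : PT N g) : PT N fun a => f a && g a := by
  convert cond hf hg (const false) using 3 with a
  cases f a <;> rfl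

theorem natEq {f g : α → ℕ} (hf : PT N f) (hg : PT N g) : PT N fun a => decide (f a = g a) := by
  convert and (isZero (hf.sub hg)) (isZero (hg.sub hf)) using 3 with a
  rw [← Bool.decide_and]
  congr 1
  rw [eq_iff_iff]
  omega

end PT

end StackProg

/-! ### The algorithm -/

namespace StackProg

open Polynomial

namespace PT

variable {N r : ℕ} {α β γ δ : Type} [TreeEnc α] [TreeEnc β] [TreeEnc γ] [TreeEnc δ]

theorem not {f : α → Bool} (hf : PT N f) : PT N fun a => !f a := by
  convert cond hf (const false) (const true) using 3 with a
  cases f a <;> rfl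

theorem boolEq {f g : α → Bool} (hf : PT N f) (hg : PT N g) : PT N fun a => decide (f a = g a) := by
  convert cond hf hg hg.not using 3 with a
  cases f a <;> cases g a <;> rfl

theorem finEq {n : ℕ} {f g : α → Fin n} (hf : PT N f) (hg : PT N g) :
    PT N fun a => decide (f a = g a) := by
  have hf' : PT N fun a => (f a : ℕ) := hf
  have hg' : PT N fun a => (g a : ℕ) := hg
  convert natEq hf' hg' using 4
  exact Fin.ext_iff

theorem letterEq {f g : α → Fin r × Bool} (hf : PT N f) (hg : PT N g) :
    PT N fun a => decide (f a = g a) := by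
  convert and (finEq hf.fst hg.fst) (boolEq hf.snd hg.snd) using 3
  rw [← Bool.decide_and]
  congr 1
  rw [Prod.ext_iff]

end PT

variable {r : ℕ}

abbrev Letter (r : ℕ) : Type := Fin r × Bool

/-- An edge from its first to its second vertex, with the letter read along it. -/
abbrev Edge (r : ℕ) : Type := ℕ × Letter r × ℕ

def linv (l : Letter r) : Letter r := (l.1, !l.2)

def relabel (p : ℕ × ℕ) (x : ℕ) : ℕ := bif decide (x = p.1) then p.2 else x

/-- Identify the vertex `p.1` with the vertex `p.2`. -/
def rename (p : ℕ × ℕ) (E : List (Edge r)) : List (Edge r) :=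
  E.map fun e => (relabel p e.1, e.2.1, relabel p e.2.2)

/-- A pair of different vertices that have to be identified. -/
def conflict (E : List (Edge r)) : Option (ℕ × ℕ) :=
  (E.filterMap fun e => (E.filterMap fun e' =>
    bif decide (e.1 = e'.1) && (decide (e.2.1 = e'.2.1) && decide (e.2.2 < e'.2.2))
    then some (e'.2.2, e.2.2) else none).head?).head?

def foldStep (E : List (Edge r)) : List (Edge r) := (conflict E).elim E fun p => rename p E

/-- Fold the graph with edges `E`. -/
def foldAll (E : List (Edge r)) : List (Edge r) := E.foldl (fun b _ => foldStep b) E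

/-- One step in the construction of a graph from a list of words. The state consists of the current
vertex, the next unused vertex, and the list of edges. -/
def buildStep (s : ℕ × ℕ × List (Edge r)) (x : Option (Letter r)) : ℕ × ℕ × List (Edge r) :=
  x.elim (0, s.2.1, rename (s.1, 0) s.2.2) fun l =>
    (s.2.1, s.2.1 + 1, (s.1, l, s.2.1) :: (s.2.1, linv l, s.1) :: s.2.2)

/-- The state after reading the instance `L`. -/
def buildState (L : List (Option (Letter r))) : ℕ × ℕ × List (Edge r) :=
  L.foldl buildStep (0, 1, [])

/-- Given for some edges a reduced path from the base vertex ending with this edge, find such paths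
that are longer by one edge. Labels of paths are stored in reverse order. -/
def extend (E : List (Edge r)) (P : List (Edge r × List (Letter r))) :
    List (Edge r × List (Letter r)) :=
  E.filterMap fun e => (P.filterMap fun p =>
    bif decide (p.1.2.2 = e.1) && !decide (e.2.1 = linv p.1.2.1)
    then some (e, e.2.1 :: p.2) else none).head?

def start (E : List (Edge r)) : List (Edge r × List (Letter r)) :=
  E.filterMap fun e => bif decide (e.1 = 0) then some (e, [e.2.1]) else none

/-- The label of a path that ends in the base vertex. -/
def closing (P : List (Edge r × List (Letter r))) : Option (List (Letter r)) :=
  (P.filterMap fun p => bif decide (p.1.2.2 = 0) then some p.2 else none).head?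

def searchStep (E : List (Edge r)) (s : List (Edge r × List (Letter r)) × Option (List (Letter r))) :
    List (Edge r × List (Letter r)) × Option (List (Letter r)) :=
  (extend E s.1, s.2.elim (closing s.1) some)

/-- The reversed label of a shortest reduced loop. -/
def search (E : List (Edge r)) : Option (List (Letter r)) :=
  (E.foldl (fun s _ => searchStep E s) (start E, none)).2

/-- The reversed solution of the shortest element problem. -/
def solve (L : List (Option (Letter r))) : Option (List (Letter r)) :=
  search (foldAll (buildState L).2.2)

/-! ### The algorithm runs in polynomial time -/

section complexity

variable {N : ℕ} {α : Type} [TreeEnc α]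

theorem linv_PT {f : α → Letter r} (hf : PT N f) : PT N fun a => linv (f a) :=
  hf.fst.pair hf.snd.not

theorem relabel_PT {p : α → ℕ × ℕ} {x : α → ℕ} (hp : PT N p) (hx : PT N x) :
    PT N fun a => relabel (p a) (x a) :=
  PT.cond (PT.natEq hx hp.fst) hp.snd hx

theorem rename_PT {p : α → ℕ × ℕ} {E : α → List (Edge r)} (hp : PT N p) (hE : PT N E) :
    PT N fun a => rename (p a) (E a) :=
  PT.map (f := fun q : α × Edge r => (relabel (p q.1) q.2.1, q.2.2.1, relabel (p q.1) q.2.2.2)) hE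
    ((relabel_PT (hp.comp PT.id.fst) PT.id.snd.fst).pair (PT.id.snd.snd.fst.pair
      (relabel_PT (hp.comp PT.id.fst) PT.id.snd.snd.snd)))

theorem conflict_PT : PT N (conflict (r := r)) := by
  refine PT.head? (PT.filterMap (f := fun q : List (Edge r) × Edge r => (q.1.filterMap fun e' =>
    bif decide (q.2.1 = e'.1) && (decide (q.2.2.1 = e'.2.1) && decide (q.2.2.2 < e'.2.2))
    then some (e'.2.2, q.2.2.2) else none).head?) PT.id (PT.head? (PT.filterMap
      (f := fun q : (List (Edge r) × Edge r) × Edge r =>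
        bif decide (q.1.2.1 = q.2.1) && (decide (q.1.2.2.1 = q.2.2.1) &&
          decide (q.1.2.2.2 < q.2.2.2))
        then some (q.2.2.2, q.1.2.2.2) else none) PT.id.fst ?_)))
  exact PT.cond (PT.and (PT.natEq PT.id.fst.snd.fst PT.id.snd.fst)
    (PT.and (PT.letterEq PT.id.fst.snd.snd.fst PT.id.snd.snd.fst)
      (PT.lt PT.id.fst.snd.snd.snd PT.id.snd.snd.snd)))
    (PT.some (PT.id.snd.snd.snd.pair PT.id.fst.snd.snd.snd)) (PT.const none)

theorem foldStep_PT : PT N (foldStep (r := r)) :=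
  PT.elim (f := fun E => E) (g := fun q : List (Edge r) × ℕ × ℕ => rename q.2 q.1) conflict_PT
    PT.id (rename_PT PT.id.snd PT.id.fst)

/-- Vertices are written in unary, so replacing one by a smaller one never lengthens the encoding.
For this reason conflicts are resolved towards the smaller vertex, and folding never exceeds the
size of the initial graph. -/
theorem sz_rename_le {p : ℕ × ℕ} (hp : p.2 ≤ p.1) (E : List (Edge r)) : sz (rename p E) ≤ sz E := by
  have h : ∀ x, sz (relabel p x) ≤ sz x := by
    intro x
    unfold relabel
    by_cases hx : x = p.1
    · simp only [hx, decide_true, cond_true, sz_nat]; omega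
    · simp only [hx, decide_false, cond_false, le_refl]
  induction E with
  | nil => exact le_rfl
  | cons e E ih =>
    obtain ⟨u, l, v⟩ := e
    have h1 := h u
    have h2 := h v
    have h3 : rename p ((u, l, v) :: E) = (relabel p u, l, relabel p v) :: rename p E := rfl
    rw [h3]
    simp only [sz_cons, sz_pair]
    omega

theorem conflict_spec {E : List (Edge r)} {p : ℕ × ℕ} (h : conflict E = some p) :
    ∃ u l, (u, l, p.2) ∈ E ∧ (u, l, p.1) ∈ E ∧ p.2 < p.1 := by
  have h1 := List.mem_of_mem_head? (Option.mem_def.2 h)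
  obtain ⟨⟨u, l, v⟩, he, h2⟩ := List.mem_filterMap.1 h1
  have h3 := List.mem_of_mem_head? (Option.mem_def.2 h2)
  obtain ⟨⟨u', l', v'⟩, he', h4⟩ := List.mem_filterMap.1 h3
  simp only [Bool.cond_eq_ite, Bool.and_eq_true, decide_eq_true_eq] at h4
  split_ifs at h4 with h5
  obtain ⟨rfl, rfl, h6⟩ := h5
  obtain rfl := Option.some.inj h4
  exact ⟨u, l, he, he', h6⟩

theorem foldAll_PT : PT N (foldAll (r := r)) :=
  PT.foldl_of_le (f := fun q : List (Edge r) × List (Edge r) × Edge r => foldStep q.2.1) PT.id PT.id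
    (foldStep_PT.comp PT.id.snd.fst) 0 fun a b c _ => by
      rw [eval_zero, add_zero]
      change sz ((conflict b).elim b fun p => rename p b) ≤ sz b
      cases h : conflict b with
      | none => exact le_rfl
      | some p =>
        obtain ⟨-, -, -, -, h⟩ := conflict_spec h
        exact sz_rename_le h.le b

theorem buildStep_PT : PT N fun q : (ℕ × ℕ × List (Edge r)) × Option (Letter r) =>
    buildStep q.1 q.2 :=
  PT.elim (f := fun q : (ℕ × ℕ × List (Edge r)) × Option (Letter r) =>
      (0, q.1.2.1, rename (q.1.1, 0) q.1.2.2))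
    (g := fun q : ((ℕ × ℕ × List (Edge r)) × Option (Letter r)) × Letter r =>
      (q.1.1.2.1, q.1.1.2.1 + 1,
        (q.1.1.1, q.2, q.1.1.2.1) :: (q.1.1.2.1, linv q.2, q.1.1.1) :: q.1.1.2.2)) PT.id.snd
    ((PT.const 0).pair (PT.id.fst.snd.fst.pair
      (rename_PT (PT.id.fst.fst.pair (PT.const 0)) PT.id.fst.snd.snd)))
    (PT.id.fst.fst.snd.fst.pair (PT.id.fst.fst.snd.fst.succ.pair
      (PT.cons (PT.id.fst.fst.fst.pair (PT.id.snd.pair PT.id.fst.fst.snd.fst))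
        (PT.cons (PT.id.fst.fst.snd.fst.pair ((linv_PT PT.id.snd).pair PT.id.fst.fst.fst))
          PT.id.fst.fst.snd.snd))))

theorem sz_letter_le (l : Letter r) : sz l ≤ 2 * r + 5 := by
  have h1 := sz_fin l.1
  have h2 := sz_bool l.2
  have h3 := l.1.isLt
  have h4 : sz l = sz l.1 + sz l.2 + 1 := rfl
  omega

/-- The bound is quadratic because of the unary vertices: a letter adds two edges, hence four vertex
names of size linear in the length read so far, and two letters of size at most `2 * r + 5`. -/
theorem sz_buildState_le (L : List (Option (Letter r))) :
    (buildState L).1 ≤ L.length ∧ (buildState L).2.1 ≤ L.length + 1 ∧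
    sz (buildState L).2.2 ≤ L.length * (8 * L.length + 4 * r + 100) + 1 := by
  induction L using List.reverseRecOn with
  | nil => simp [buildState, sz_nil]
  | append_singleton L x ih =>
    obtain ⟨h1, h2, h3⟩ := ih
    have h4 : buildState (L ++ [x]) = buildStep (buildState L) x := by
      simp only [buildState, List.foldl_append, List.foldl_cons, List.foldl_nil]
    rw [h4, List.length_append, List.length_singleton]
    have h5 : L.length * (8 * L.length + 4 * r + 100) + (8 * L.length + 4 * r + 100) ≤
      (L.length + 1) * (8 * (L.length + 1) + 4 * r + 100) := by nlinarith
    cases x with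
    | none =>
      have h6 := sz_rename_le (p := ((buildState L).1, 0)) (Nat.zero_le _) (buildState L).2.2
      refine ⟨Nat.zero_le _, ?_, ?_⟩
      · change (buildState L).2.1 ≤ _
        omega
      · change sz (rename ((buildState L).1, 0) (buildState L).2.2) ≤ _
        omega
    | some l =>
      refine ⟨?_, ?_, ?_⟩
      · change (buildState L).2.1 ≤ _
        omega
      · change (buildState L).2.1 + 1 ≤ _
        omega
      · change sz (((buildState L).1, l, (buildState L).2.1) ::
          ((buildState L).2.1, linv l, (buildState L).1) :: (buildState L).2.2) ≤ _
        simp only [sz_cons, sz_pair, sz_nat]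
        have := sz_letter_le l
        have := sz_letter_le (linv l)
        omega

theorem buildState_PT : PT N (buildState (r := r)) := by
  refine PT.foldl (f := fun q : List (Option (Letter r)) × (ℕ × ℕ × List (Edge r)) ×
    Option (Letter r) => buildStep q.2.1 q.2.2) PT.id (PT.const (0, 1, []))
    (buildStep_PT.comp PT.id.snd) (X * (C 8 * X + C (4 * r + 100)) + C 4 * X + C 20) fun a i => ?_
  obtain ⟨h1, h2, h3⟩ := sz_buildState_le (a.take i)
  have h4 : (a.take i).length ≤ sz a := (List.length_take_le' _ _).trans (length_le_sz a)
  change sz (buildState (a.take i)) ≤ _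
  have h5 : sz (buildState (a.take i)) = sz (buildState (a.take i)).1 +
    (sz (buildState (a.take i)).2.1 + sz (buildState (a.take i)).2.2 + 1) + 1 := rfl
  have h6 := h3.trans (Nat.add_le_add_right (Nat.mul_le_mul h4
    (show 8 * (a.take i).length + 4 * r + 100 ≤ 8 * sz a + (4 * r + 100) by omega)) 1)
  rw [h5, sz_nat, sz_nat]
  simp only [eval_add, eval_mul, eval_C, eval_X]
  omega

theorem extend_PT : PT N fun q : List (Edge r) × List (Edge r × List (Letter r)) =>
    extend q.1 q.2 := by
  refine PT.filterMap (f := fun q : (List (Edge r) × List (Edge r × List (Letter r))) × Edge r =>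
    (q.1.2.filterMap fun p => bif decide (p.1.2.2 = q.2.1) && !decide (q.2.2.1 = linv p.1.2.1)
    then some (q.2, q.2.2.1 :: p.2) else none).head?) PT.id.fst (PT.head? (PT.filterMap
    (f := fun q : ((List (Edge r) × List (Edge r × List (Letter r))) × Edge r) ×
      Edge r × List (Letter r) =>
      bif decide (q.2.1.2.2 = q.1.2.1) && !decide (q.1.2.2.1 = linv q.2.1.2.1)
      then some (q.1.2, q.1.2.2.1 :: q.2.2) else none) PT.id.fst.snd ?_))
  exact PT.cond (PT.and (PT.natEq PT.id.snd.fst.snd.snd PT.id.fst.snd.fst)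
    (PT.letterEq PT.id.fst.snd.snd.fst (linv_PT PT.id.snd.fst.snd.fst)).not)
    (PT.some (PT.id.fst.snd.pair (PT.cons PT.id.fst.snd.snd.fst PT.id.snd.snd))) (PT.const none)

theorem start_PT : PT N (start (r := r)) :=
  PT.filterMap (f := fun q : List (Edge r) × Edge r =>
    bif decide (q.2.1 = 0) then some (q.2, [q.2.2.1]) else none) PT.id
    (PT.cond (PT.isZero PT.id.snd.fst)
      (PT.some (PT.id.snd.pair (PT.cons PT.id.snd.snd.fst (PT.const [])))) (PT.const none))

theorem closing_PT : PT N (closing (r := r)) :=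
  PT.head? (PT.filterMap (f := fun q : List (Edge r × List (Letter r)) × Edge r × List (Letter r) =>
    bif decide (q.2.1.2.2 = 0) then some q.2.2 else none) PT.id
    (PT.cond (PT.isZero PT.id.snd.fst.snd.snd) (PT.some PT.id.snd.snd) (PT.const none)))

theorem searchStep_PT : PT N fun q : List (Edge r) ×
    (List (Edge r × List (Letter r)) × Option (List (Letter r))) × Edge r =>
    searchStep q.1 q.2.1 :=
  (extend_PT.comp₂ PT.id.fst PT.id.snd.fst.fst).pair
    (PT.elim (g := fun q : (List (Edge r) ×
      (List (Edge r × List (Letter r)) × Option (List (Letter r))) × Edge r) × List (Letter r) =>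
        some q.2) PT.id.snd.fst.snd (closing_PT.comp PT.id.snd.fst.fst) PT.id.snd.some)

theorem mem_extend {E : List (Edge r)} {P : List (Edge r × List (Letter r))}
    {q : Edge r × List (Letter r)} (h : q ∈ extend E P) :
    q.1 ∈ E ∧ ∃ p ∈ P, p.1.2.2 = q.1.1 ∧ q.1.2.1 ≠ linv p.1.2.1 ∧ q.2 = q.1.2.1 :: p.2 := by
  obtain ⟨e, he, h2⟩ := List.mem_filterMap.1 h
  have h3 := List.mem_of_mem_head? (Option.mem_def.2 h2)
  obtain ⟨p, hp, h4⟩ := List.mem_filterMap.1 h3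
  simp only [Bool.cond_eq_ite, Bool.and_eq_true, decide_eq_true_eq, Bool.not_eq_true',
    decide_eq_false_iff_not] at h4
  split_ifs at h4 with h5
  obtain rfl := Option.some.inj h4
  exact ⟨he, p, hp, h5.1, h5.2, rfl⟩

theorem mem_start {E : List (Edge r)} {q : Edge r × List (Letter r)} :
    q ∈ start E ↔ q.1 ∈ E ∧ q.1.1 = 0 ∧ q.2 = [q.1.2.1] := by
  unfold start
  rw [List.mem_filterMap]
  constructor
  · rintro ⟨e, he, h4⟩
    simp only [Bool.cond_eq_ite, decide_eq_true_eq] at h4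
    split_ifs at h4 with h5
    obtain rfl := Option.some.inj h4
    exact ⟨he, h5, rfl⟩
  · rintro ⟨he, h0, h⟩
    refine ⟨q.1, he, ?_⟩
    simp [h0, ← h]

theorem closing_mem {P : List (Edge r × List (Letter r))} {w : List (Letter r)}
    (h : closing P = some w) : ∃ p ∈ P, p.1.2.2 = 0 ∧ p.2 = w := by
  obtain ⟨p, hp, h4⟩ := List.mem_filterMap.1 (List.mem_of_mem_head? (Option.mem_def.2 h))
  simp only [Bool.cond_eq_ite, decide_eq_true_eq] at h4
  split_ifs at h4 with h5
  exact ⟨p, hp, h5, Option.some.inj h4⟩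

/-- The state of the search after `i` steps. -/
def searchState (E : List (Edge r)) (i : ℕ) :
    List (Edge r × List (Letter r)) × Option (List (Letter r)) :=
  (searchStep E)^[i] (start E, none)

theorem searchState_succ (E : List (Edge r)) (i : ℕ) :
    searchState E (i + 1) = searchStep E (searchState E i) :=
  Function.iterate_succ_apply' _ _ _

theorem length_of_mem_searchState {E : List (Edge r)} {i : ℕ} :
    ∀ q ∈ (searchState E i).1, q.1 ∈ E ∧ q.2.length = i + 1 := by
  induction i with
  | zero =>
    intro q hq
    obtain ⟨h1, h2, h3⟩ := mem_start.1 hq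
    exact ⟨h1, by simp [h3]⟩
  | succ i ih =>
    intro q hq
    rw [searchState_succ] at hq
    obtain ⟨h1, p, hp, -, -, h2⟩ := mem_extend hq
    exact ⟨h1, by simp [h2, (ih p hp).2]⟩

theorem length_searchState_le (E : List (Edge r)) (i : ℕ) :
    (searchState E i).1.length ≤ E.length := by
  cases i with
  | zero => exact List.length_filterMap_le _ _
  | succ i => rw [searchState_succ]; exact List.length_filterMap_le _ _

theorem length_searchState_snd {E : List (Edge r)} {i : ℕ} {w : List (Letter r)}
    (h : (searchState E i).2 = some w) : w.length ≤ i := by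
  induction i generalizing w with
  | zero => simp [searchState] at h
  | succ i ih =>
    rw [searchState_succ] at h
    change (searchState E i).2.elim (closing (searchState E i).1) some = some w at h
    cases h' : (searchState E i).2 with
    | none =>
      rw [h'] at h
      obtain ⟨p, hp, -, rfl⟩ := closing_mem h
      exact (length_of_mem_searchState p hp).2.le
    | some w' =>
      rw [h'] at h
      obtain rfl := Option.some.inj h
      exact (ih h').trans (Nat.le_succ i)

theorem search_eq (E : List (Edge r)) : search E = (searchState E E.length).2 := by
  unfold search searchState
  rw [List.foldl_const]

/-- Since only one path is kept per edge, the state after `i` steps has at most `E.length` entries,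
each with an edge of `E` and a label of `i + 1` letters. The list folded over serves only as a step
counter. -/
theorem search_PT : PT N (search (r := r)) := by
  refine PT.snd (PT.foldl (f := fun q : List (Edge r) × (List (Edge r × List (Letter r)) ×
    Option (List (Letter r))) × Edge r => searchStep q.1 q.2.1) PT.id
    (start_PT.pair (PT.const none)) searchStep_PT
    (X * (X + (X + C 1) * C (2 * r + 6) + C 3) + X * C (2 * r + 6) + C 6) fun E i => ?_)
  dsimp only
  rw [List.foldl_const]
  change sz (searchState E (E.take i).length) ≤ _
  have hi : (E.take i).length ≤ sz E := (List.length_take_le' _ _).trans (length_le_sz E)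
  generalize (E.take i).length = i at hi
  have hw : ∀ w : List (Letter r), sz w ≤ w.length * (2 * r + 6) + 1 := fun w =>
    sz_le_of_forall (B := 2 * r + 5) fun l _ => sz_letter_le l
  have h1 : sz (searchState E i).1 ≤ sz E * (sz E + (sz E + 1) * (2 * r + 6) + 2 + 1) + 1 := by
    refine (sz_le_of_forall (B := sz E + (sz E + 1) * (2 * r + 6) + 2) fun q hq => ?_).trans
      (Nat.add_le_add_right (Nat.mul_le_mul_right _
        ((length_searchState_le E i).trans (length_le_sz E))) _)
    obtain ⟨h2, h3⟩ := length_of_mem_searchState q hq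
    have h4 := hw q.2
    have h5 := sz_mem h2
    have h6 := Nat.mul_le_mul_right (2 * r + 6) (show q.2.length ≤ sz E + 1 by omega)
    have h7 : sz q = sz q.1 + sz q.2 + 1 := rfl
    omega
  have h2 : sz (searchState E i).2 ≤ sz E * (2 * r + 6) + 3 := by
    cases h : (searchState E i).2 with
    | none => rw [sz_none]; omega
    | some w =>
      have h3 := (length_searchState_snd h).trans hi
      have h4 := hw w
      have h5 := Nat.mul_le_mul_right (2 * r + 6) h3
      rw [sz_some]
      omega
  have h3 : sz (searchState E i) = sz (searchState E i).1 + sz (searchState E i).2 + 1 := rfl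
  rw [h3]
  simp only [eval_add, eval_mul, eval_C, eval_X, add_assoc] at h1 h2 ⊢
  norm_num at h1
  omega

theorem solve_PT : PT N (solve (r := r)) :=
  search_PT.comp (foldAll_PT.comp buildState_PT.snd.snd)

end complexity

end StackProg

/-! ### Words read along walks in labelled graphs -/

open FreeGroup (IsReduced)

namespace LabelledGraph

variable {ι : Type} {Γ : LabelledGraph ι}

/-- The word `w` can be read from `u` to `v`. -/
inductive Walk (Γ : LabelledGraph ι) : Γ.V → GroupWord ι → Γ.V → Prop
  | nil (v : Γ.V) : Walk Γ v [] v
  | cons {u v x : Γ.V} {l : ι × Bool} {w : GroupWord ι} :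
      Γ.Reads u l v → Walk Γ v w x → Walk Γ u (l :: w) x

theorem Reads.inv {u v : Γ.V} {l : ι × Bool} (h : Γ.Reads u l v) : Γ.Reads v (l.1, !l.2) u := by
  obtain ⟨i, b⟩ := l
  cases b <;> simpa [Reads] using h

theorem Walk.append {u v x : Γ.V} {w w' : GroupWord ι} (h : Γ.Walk u w v) (h' : Γ.Walk v w' x) :
    Γ.Walk u (w ++ w') x := by
  induction h with
  | nil => exact h'
  | cons hr _ ih => exact .cons hr (ih h')

theorem Walk.single {u v : Γ.V} {l : ι × Bool} (h : Γ.Reads u l v) : Γ.Walk u [l] v :=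
  .cons h (.nil v)

theorem walk_append_iff {u x : Γ.V} {w w' : GroupWord ι} :
    Γ.Walk u (w ++ w') x ↔ ∃ v, Γ.Walk u w v ∧ Γ.Walk v w' x := by
  refine ⟨fun h => ?_, fun ⟨v, h, h'⟩ => h.append h'⟩
  induction w generalizing u with
  | nil => exact ⟨u, .nil u, h⟩
  | cons l w ih =>
    cases h with
    | cons hr h =>
      obtain ⟨v, h1, h2⟩ := ih h
      exact ⟨v, .cons hr h1, h2⟩

theorem walk_cons_iff {u x : Γ.V} {l : ι × Bool} {w : GroupWord ι} :
    Γ.Walk u (l :: w) x ↔ ∃ v, Γ.Reads u l v ∧ Γ.Walk v w x :=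
  ⟨fun h => by cases h with | cons hr h => exact ⟨_, hr, h⟩, fun ⟨_, h, h'⟩ => .cons h h'⟩

theorem walk_nil_iff {u x : Γ.V} : Γ.Walk u [] x ↔ u = x :=
  ⟨fun h => by cases h; rfl, fun h => h ▸ .nil u⟩

theorem Walk.invRev {u v : Γ.V} {w : GroupWord ι} (h : Γ.Walk u w v) :
    Γ.Walk v (FreeGroup.invRev w) u := by
  induction h with
  | nil => exact .nil _
  | cons hr _ ih =>
    rw [FreeGroup.invRev_cons]
    exact ih.append (.single hr.inv)

/-- No letter can be read from a vertex to two different vertices. -/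
def Deterministic (Γ : LabelledGraph ι) : Prop :=
  ∀ ⦃u l v v'⦄, Γ.Reads u l v → Γ.Reads u l v' → v = v'

/-- A cancelling pair of letters is read along an edge and then along an edge with the inverse
letter; by determinism the latter returns to where the former began, so the pair can be cut out. -/
theorem Walk.red {u v : Γ.V} {w w' : GroupWord ι} (hΓ : Γ.Deterministic) (hw : FreeGroup.Red w w')
    (h : Γ.Walk u w v) : Γ.Walk u w' v := by
  induction hw with
  | refl => exact h
  | tail _ hs ih =>
    cases hs with
    | not =>
      obtain ⟨x, h1, h2⟩ := walk_append_iff.1 ih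
      obtain ⟨y, h3, h4⟩ := walk_cons_iff.1 h2
      obtain ⟨z, h5, h6⟩ := walk_cons_iff.1 h4
      obtain rfl := hΓ h3.inv h5
      exact h1.append h6

theorem Walk.reduce [DecidableEq ι] {u v : Γ.V} {w : GroupWord ι} (hΓ : Γ.Deterministic)
    (h : Γ.Walk u w v) : Γ.Walk u (FreeGroup.reduce w) v :=
  h.red hΓ FreeGroup.reduce.red

/-- A map from the vertices of a graph to the cosets of `H` that is compatible with reading
letters. -/
structure IsCosetMap (Γ : LabelledGraph ι) (H : Subgroup (FreeGroup ι))
    (c : Γ.V → FreeGroup ι ⧸ H) : Prop where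
  base : c Γ.base = ((1 : FreeGroup ι) : FreeGroup ι ⧸ H)
  edge : ∀ ⦃u i v⦄, Γ.E u i v → FreeGroup.of i • c v = c u

theorem IsCosetMap.reads {H : Subgroup (FreeGroup ι)} {c : Γ.V → FreeGroup ι ⧸ H}
    (hc : Γ.IsCosetMap H c) {u v : Γ.V} {l : ι × Bool} (h : Γ.Reads u l v) :
    FreeGroup.mk [l] • c v = c u := by
  obtain ⟨i, b⟩ := l
  cases b
  · have h1 : FreeGroup.mk [(i, false)] = (FreeGroup.of i)⁻¹ := rfl
    rw [h1, inv_smul_eq_iff]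
    exact (hc.edge h).symm
  · exact hc.edge h

/-- With left cosets, the vertex reached from the base by reading `w` is sent to the coset of `w⁻¹`.
For a loop at the base this says that `w` fixes the trivial coset, that is, `w` lies in `H`. -/
theorem IsCosetMap.walk {H : Subgroup (FreeGroup ι)} {c : Γ.V → FreeGroup ι ⧸ H}
    (hc : Γ.IsCosetMap H c) {u v : Γ.V} {w : GroupWord ι} (h : Γ.Walk u w v) :
    FreeGroup.mk w • c v = c u := by
  induction h with
  | nil => rw [← FreeGroup.one_eq_mk, one_smul]
  | @cons u v x l w hr _ ih =>
    rw [← hc.reads hr, ← ih, smul_smul, FreeGroup.mul_mk, List.singleton_append]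

theorem IsCosetMap.mem {H : Subgroup (FreeGroup ι)} {c : Γ.V → FreeGroup ι ⧸ H}
    (hc : Γ.IsCosetMap H c) {w : GroupWord ι} (h : Γ.Walk Γ.base w Γ.base) : FreeGroup.mk w ∈ H := by
  have h1 := hc.walk h
  rw [hc.base, MulAction.Quotient.smul_coe, smul_eq_mul, mul_one, eq_comm, QuotientGroup.eq,
    inv_one, one_mul] at h1
  exact h1

/-- In a deterministic graph with a coset map, the elements of the subgroup are read along the loops
at the base vertex as soon as this holds for generators. -/
theorem walk_base_iff [DecidableEq ι] {H : Subgroup (FreeGroup ι)} {c : Γ.V → FreeGroup ι ⧸ H}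
    (hc : Γ.IsCosetMap H c) (hΓ : Γ.Deterministic) {hs : List (GroupWord ι)}
    (hH : H = Subgroup.closure {g | ∃ h ∈ hs, FreeGroup.mk h = g})
    (hl : ∀ h ∈ hs, Γ.Walk Γ.base h Γ.base) {w : GroupWord ι} (hw : IsReduced w) :
    Γ.Walk Γ.base w Γ.base ↔ FreeGroup.mk w ∈ H := by
  refine ⟨hc.mem, fun h => ?_⟩
  -- The elements whose reduced word labels a loop at the base. Determinism is what makes this
  -- closed under products: the concatenation of two loops may be reduced.
  let K : Subgroup (FreeGroup ι) :=
    { carrier := {g | Γ.Walk Γ.base g.toWord Γ.base}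
      mul_mem' := fun {a b} ha hb => by
        rw [Set.mem_ofPred_eq, FreeGroup.toWord_mul]
        exact (Walk.append ha hb).reduce hΓ
      one_mem' := by
        rw [Set.mem_ofPred_eq, FreeGroup.toWord_one]
        exact .nil _
      inv_mem' := fun {a} ha => by
        rw [Set.mem_ofPred_eq, FreeGroup.toWord_inv]
        exact Walk.invRev ha }
  have hK : H ≤ K := by
    rw [hH, Subgroup.closure_le]
    rintro g ⟨h, hh, rfl⟩
    change Γ.Walk Γ.base (FreeGroup.mk h).toWord Γ.base
    rw [FreeGroup.toWord_mk]
    exact (hl h hh).reduce hΓ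
  have h1 : Γ.Walk Γ.base (FreeGroup.mk w).toWord Γ.base := hK h
  rwa [FreeGroup.toWord_mk, hw.reduce_eq] at h1

/-! ### Reduced loops -/

theorem IsPath.walk {u v : Γ.V} {p : List (LabelledStep Γ.V ι)} (h : Γ.IsPath u p v) :
    Γ.Walk u (p.map LabelledStep.lab) v := by
  induction h with
  | nil => exact .nil _
  | cons hr _ ih => exact .cons hr ih

theorem Walk.exists_isPath {u v : Γ.V} {w : GroupWord ι} (h : Γ.Walk u w v) :
    ∃ p, Γ.IsPath u p v ∧ p.map LabelledStep.lab = w := by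
  induction h with
  | nil => exact ⟨[], .nil _, rfl⟩
  | cons hr _ ih =>
    obtain ⟨p, hp, rfl⟩ := ih
    exact ⟨_, .cons hr hp, rfl⟩

theorem letter_ne_inv_iff {l l' : ι × Bool} : l' ≠ (l.1, !l.2) ↔ (l.1 = l'.1 → l.2 = l'.2) := by
  obtain ⟨i, b⟩ := l
  obtain ⟨i', b'⟩ := l'
  cases b <;> cases b' <;> simp [eq_comm]

/-- Only determinism excludes that a step with the inverse letter runs along a different edge: it
starts where the previous step ends, as does the reversed step, and therefore coincides with it. -/
theorem IsPath.isChain_iff (hΓ : Γ.Deterministic) {u v : Γ.V} {p : List (LabelledStep Γ.V ι)}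
    (h : Γ.IsPath u p v) :
    (p.IsChain fun d e => e ≠ d.inv) ↔ IsReduced (p.map LabelledStep.lab) := by
  induction h with
  | nil => simp
  | @cons u v x l p hr hp ih =>
    cases hp with
    | nil => simp
    | @cons _ y _ l' p hr' hp =>
      rw [List.isChain_cons_cons, ih]
      simp only [List.map_cons]
      rw [FreeGroup.isReduced_cons_cons, ← letter_ne_inv_iff]
      refine and_congr (not_congr ⟨fun h => congrArg LabelledStep.lab h, fun h => ?_⟩) Iff.rfl
      obtain rfl : l' = (l.1, !l.2) := h
      obtain rfl := hΓ hr.inv hr'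
      rfl

theorem exists_isReducedLoop_iff (hΓ : Γ.Deterministic) {w : GroupWord ι} :
    (∃ p, Γ.IsReducedLoop p ∧ p.map LabelledStep.lab = w) ↔
      IsReduced w ∧ Γ.Walk Γ.base w Γ.base := by
  constructor
  · rintro ⟨p, ⟨hp, hc⟩, rfl⟩
    exact ⟨(hp.isChain_iff hΓ).1 hc, hp.walk⟩
  · rintro ⟨hw, h⟩
    obtain ⟨p, hp, rfl⟩ := h.exists_isPath
    exact ⟨p, ⟨hp, (hp.isChain_iff hΓ).2 hw⟩, rfl⟩

/-! ### Folding -/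

theorem mk_reads {u v : Γ.V} {l : ι × Bool} (h : Γ.Reads u l v) :
    Γ.folded.Reads (Quotient.mk Γ.foldSetoid u) l (Quotient.mk Γ.foldSetoid v) := by
  obtain ⟨i, b⟩ := l
  cases b <;> exact ⟨_, _, rfl, rfl, h⟩

theorem mk_walk {u v : Γ.V} {w : GroupWord ι} (h : Γ.Walk u w v) :
    Γ.folded.Walk (Quotient.mk Γ.foldSetoid u) w (Quotient.mk Γ.foldSetoid v) := by
  induction h with
  | nil => exact .nil _
  | cons hr _ ih => exact .cons (mk_reads hr) ih

theorem folded_reads {p q : Γ.folded.V} {l : ι × Bool} (h : Γ.folded.Reads p l q) :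
    ∃ u v, Quotient.mk Γ.foldSetoid u = p ∧ Quotient.mk Γ.foldSetoid v = q ∧ Γ.Reads u l v := by
  obtain ⟨i, b⟩ := l
  cases b
  · obtain ⟨u, v, hu, hv, h⟩ := h
    exact ⟨v, u, hv, hu, h⟩
  · exact h

theorem folded_deterministic : Γ.folded.Deterministic := by
  intro p l q q' h h'
  obtain ⟨u, v, rfl, rfl, hr⟩ := folded_reads h
  obtain ⟨u', v', hu, rfl, hr'⟩ := folded_reads h'
  exact Quotient.sound (.fold (Quotient.exact hu.symm) hr hr')

/-- Group elements act injectively on cosets, so equal letters read from vertices in the same coset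
end in the same coset. Folding thus identifies only vertices with equal image and creates no loops
with labels outside `H`. -/
theorem IsCosetMap.foldRel {H : Subgroup (FreeGroup ι)} {c : Γ.V → FreeGroup ι ⧸ H}
    (hc : Γ.IsCosetMap H c) {u v : Γ.V} (h : Γ.FoldRel u v) : c u = c v := by
  induction h with
  | refl => rfl
  | symm _ ih => exact ih.symm
  | trans _ _ ih ih' => exact ih.trans ih'
  | fold _ hr hr' ih => rw [← hc.reads hr, ← hc.reads hr'] at ih; exact smul_left_cancel _ ih

theorem IsCosetMap.folded {H : Subgroup (FreeGroup ι)} {c : Γ.V → FreeGroup ι ⧸ H}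
    (hc : Γ.IsCosetMap H c) :
    Γ.folded.IsCosetMap H (Quotient.lift c fun _ _ h => hc.foldRel h) where
  base := hc.base
  edge := by
    rintro _ i _ ⟨u, v, rfl, rfl, h⟩
    exact hc.edge h

end LabelledGraph

/-! ### Cosets and loops in the bouquet -/

section Bouquet

variable {ι : Type}

theorem bouquetPoint_zero (hs : List (GroupWord ι)) (i : Fin hs.length) :
    bouquetPoint hs i 0 = none := by simp [bouquetPoint]

theorem bouquetPoint_length (hs : List (GroupWord ι)) (i : Fin hs.length) :
    bouquetPoint hs i (hs.get i).length = none := by simp [bouquetPoint]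

/-- The coset of a vertex of a bouquet. -/
def bouquetCoset (hs : List (GroupWord ι)) (H : Subgroup (FreeGroup ι)) :
    BouquetVertex hs → FreeGroup ι ⧸ H
  | none => ((1 : FreeGroup ι) : FreeGroup ι ⧸ H)
  | some ⟨i, j⟩ => (((FreeGroup.mk ((hs.get i).take (j + 1)))⁻¹ : FreeGroup ι) : FreeGroup ι ⧸ H)

/-- The vertex after a prefix is sent to the coset of the inverse prefix. At the end of a word this
has to agree with the trivial coset of the base vertex, and it does as the word represents an
element of `H`. -/
theorem bouquetCoset_point {hs : List (GroupWord ι)} {H : Subgroup (FreeGroup ι)}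
    (hH : ∀ h ∈ hs, FreeGroup.mk h ∈ H) (i : Fin hs.length) {j : ℕ} (hj : j ≤ (hs.get i).length) :
    bouquetCoset hs H (bouquetPoint hs i j) =
      (((FreeGroup.mk ((hs.get i).take j))⁻¹ : FreeGroup ι) : FreeGroup ι ⧸ H) := by
  unfold bouquetPoint
  split_ifs with h
  · simp only [bouquetCoset]
    rw [Nat.sub_add_cancel h.1]
  · simp only [bouquetCoset]
    rcases Nat.eq_zero_or_pos j with rfl | hj'
    · rw [List.take_zero, ← FreeGroup.one_eq_mk, inv_one]
    · have : j = (hs.get i).length := by omega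
      subst this
      rw [List.take_length, QuotientGroup.eq, inv_one, one_mul]
      exact H.inv_mem (hH _ (List.get_mem _ _))

theorem mk_take_succ (h : GroupWord ι) (j : Fin h.length) :
    FreeGroup.mk (h.take (j + 1)) = FreeGroup.mk (h.take j) * FreeGroup.mk [h.get j] := by
  rw [FreeGroup.mul_mk, List.get_eq_getElem, List.take_succ_eq_append_getElem j.isLt]

theorem isCosetMap_bouquet {hs : List (GroupWord ι)} {H : Subgroup (FreeGroup ι)}
    (hH : ∀ h ∈ hs, FreeGroup.mk h ∈ H) : (bouquet hs).IsCosetMap H (bouquetCoset hs H) where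
  base := rfl
  edge := by
    rintro _ x _ ⟨i, j, ⟨hx, rfl, rfl⟩ | ⟨hx, rfl, rfl⟩⟩
    · rw [bouquetCoset_point hH i j.isLt.le, bouquetCoset_point hH i j.isLt, mk_take_succ, hx,
        MulAction.Quotient.smul_coe, smul_eq_mul, mul_inv_rev]
      exact congrArg _ (mul_inv_cancel_left (FreeGroup.of x) _)
    · rw [bouquetCoset_point hH i j.isLt.le, bouquetCoset_point hH i j.isLt, mk_take_succ, hx,
        MulAction.Quotient.smul_coe, smul_eq_mul, mul_inv_rev]
      congr 2

theorem bouquet_reads (hs : List (GroupWord ι)) (i : Fin hs.length) (j : Fin (hs.get i).length) :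
    (bouquet hs).Reads (bouquetPoint hs i j) ((hs.get i).get j) (bouquetPoint hs i (j + 1)) := by
  rcases hx : (hs.get i).get j with ⟨x, b⟩
  cases b
  · exact ⟨i, j, .inr ⟨hx, rfl, rfl⟩⟩
  · exact ⟨i, j, .inl ⟨hx, rfl, rfl⟩⟩

theorem bouquet_walk {hs : List (GroupWord ι)} {h : GroupWord ι} (hh : h ∈ hs) :
    (bouquet hs).Walk none h none := by
  obtain ⟨i, rfl⟩ := List.get_of_mem hh
  have key : ∀ j ≤ (hs.get i).length,
      (bouquet hs).Walk none ((hs.get i).take j) (bouquetPoint hs i j) := by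
    intro j
    induction j with
    | zero =>
      intro _
      rw [bouquetPoint_zero, List.take_zero]
      exact .nil _
    | succ j ih =>
      intro hj
      rw [List.take_succ_eq_append_getElem hj]
      exact (ih (by omega)).append (.single (bouquet_reads hs i ⟨j, hj⟩))
  have := key _ le_rfl
  rwa [bouquetPoint_length, List.take_length] at this

end Bouquet

/-- The reduced words of minimal positive length that represent elements of `H`. -/
def IsShortestWord {ι : Type} (H : Subgroup (FreeGroup ι)) (w : GroupWord ι) : Prop :=
  IsReduced w ∧ FreeGroup.mk w ∈ H ∧ w ≠ [] ∧
    ∀ w', IsReduced w' → FreeGroup.mk w' ∈ H → w' ≠ [] → w.length ≤ w'.length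

theorem stallingsGraph_walk_iff {ι : Type} [DecidableEq ι] {hs : List (GroupWord ι)}
    {w : GroupWord ι} (hw : IsReduced w) :
    (stallingsGraph hs).Walk (stallingsGraph hs).base w (stallingsGraph hs).base ↔
      FreeGroup.mk w ∈ Subgroup.closure {g | ∃ h ∈ hs, FreeGroup.mk h = g} := by
  refine LabelledGraph.walk_base_iff (hs := hs.map FreeGroup.reduce)
    (LabelledGraph.IsCosetMap.folded (isCosetMap_bouquet ?_)) LabelledGraph.folded_deterministic
    ?_ ?_ hw
  · intro h hh
    obtain ⟨h, hh', rfl⟩ := List.mem_map.1 hh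
    rw [FreeGroup.reduce.self]
    exact Subgroup.subset_closure ⟨h, hh', rfl⟩
  · congr 1
    ext g
    simp [FreeGroup.reduce.self]
  · exact fun h hh => LabelledGraph.mk_walk (bouquet_walk hh)

theorem exists_isShortestReducedLoop_iff {ι : Type} [DecidableEq ι] {hs : List (GroupWord ι)}
    {w : GroupWord ι} :
    (∃ p, (stallingsGraph hs).IsShortestReducedLoop p ∧ p.map LabelledStep.lab = w) ↔
      IsShortestWord (Subgroup.closure {g | ∃ h ∈ hs, FreeGroup.mk h = g}) w := by
  have key : ∀ w, (∃ p, (stallingsGraph hs).IsReducedLoop p ∧ p.map LabelledStep.lab = w) ↔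
      IsReduced w ∧ FreeGroup.mk w ∈ Subgroup.closure {g | ∃ h ∈ hs, FreeGroup.mk h = g} := fun w =>
    (LabelledGraph.exists_isReducedLoop_iff LabelledGraph.folded_deterministic).trans
      (and_congr_right fun hw => stallingsGraph_walk_iff hw)
  constructor
  · rintro ⟨p, ⟨hp, hne, hmin⟩, rfl⟩
    obtain ⟨h1, h2⟩ := (key _).1 ⟨p, hp, rfl⟩
    refine ⟨h1, h2, by simpa using hne, fun w' h1' h2' hne' => ?_⟩
    obtain ⟨q, hq, rfl⟩ := (key w').2 ⟨h1', h2'⟩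
    simpa using hmin q hq (by simpa using hne')
  · rintro ⟨h1, h2, hne, hmin⟩
    obtain ⟨p, hp, rfl⟩ := (key w).2 ⟨h1, h2⟩
    refine ⟨p, ⟨hp, by simpa using hne, fun q hq hne' => ?_⟩, rfl⟩
    obtain ⟨h1', h2'⟩ := (key _).1 ⟨q, hq, rfl⟩
    simpa using hmin _ h1' h2' (by simpa using hne')

/-! ### Word metric and geodesics of a free group with a basis -/

section FreeBasis

variable {ι : Type} {G : Type*} [Group G] (b : FreeGroupBasis ι G)

theorem evalWord_basis (w : GroupWord ι) :
    evalWord (fun i => b i) w = b.repr.symm (FreeGroup.mk w) := by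
  have h : (b.repr.symm : FreeGroup ι →* G) = FreeGroup.lift fun i => b i := by
    ext i
    rw [FreeGroup.lift_apply_of]
    rfl
  calc evalWord (fun i => b i) w = FreeGroup.lift (fun i => b i) (FreeGroup.mk w) := by
        rw [FreeGroup.lift_mk, evalWord]
        congr 2
        funext l
        cases l.2 <;> rfl
    _ = _ := by rw [← h]; rfl

theorem wordSubgroup_basis (hs : List (GroupWord ι)) : wordSubgroup (fun i => b i) hs =
    (Subgroup.closure {g | ∃ h ∈ hs, FreeGroup.mk h = g}).map (b.repr.symm : FreeGroup ι →* G) := by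
  rw [MonoidHom.map_closure, wordSubgroup]
  congr 1
  ext g
  simp only [Set.mem_ofPred_eq, Set.mem_image, evalWord_basis]
  constructor
  · rintro ⟨h, hh, rfl⟩
    exact ⟨_, ⟨h, hh, rfl⟩, rfl⟩
  · rintro ⟨_, ⟨h, hh, rfl⟩, rfl⟩
    exact ⟨h, hh, rfl⟩

theorem evalWord_mem_iff {hs : List (GroupWord ι)} {w : GroupWord ι} :
    evalWord (fun i => b i) w ∈ wordSubgroup (fun i => b i) hs ↔
      FreeGroup.mk w ∈ Subgroup.closure {g | ∃ h ∈ hs, FreeGroup.mk h = g} := by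
  rw [evalWord_basis, wordSubgroup_basis]
  exact Subgroup.mem_map_iff_mem (f := (b.repr.symm : FreeGroup ι →* G)) b.repr.symm.injective

theorem evalWord_eq_iff {u w : GroupWord ι} :
    evalWord (fun i => b i) u = evalWord (fun i => b i) w ↔ FreeGroup.mk u = FreeGroup.mk w := by
  rw [evalWord_basis, evalWord_basis, b.repr.symm.injective.eq_iff]

theorem evalWord_eq_one_iff {w : GroupWord ι} :
    evalWord (fun i => b i) w = 1 ↔ FreeGroup.mk w = 1 := by
  rw [evalWord_basis, map_eq_one_iff _ b.repr.symm.injective]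

variable [DecidableEq ι]

/-- All words for an element have the same reduced form, and reducing never lengthens a word. -/
theorem wordLength_basis (w : GroupWord ι) :
    wordLength (fun i => b i) (evalWord (fun i => b i) w) = (FreeGroup.reduce w).length := by
  refine le_antisymm (Nat.sInf_le ⟨_, (evalWord_eq_iff b).2 FreeGroup.reduce.self, rfl⟩) ?_
  refine le_csInf ⟨_, w, rfl, rfl⟩ ?_
  rintro n ⟨u, hu, rfl⟩
  rw [← FreeGroup.reduce.sound ((evalWord_eq_iff b).1 hu)]
  exact FreeGroup.norm_mk_le

/-- The reduced form of a word is a sublist of it, so a geodesic word, being no longer than its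
reduced form, equals it. -/
theorem isGeodesicWord_iff {w : GroupWord ι} : IsGeodesicWord (fun i => b i) w ↔ IsReduced w := by
  constructor
  · intro h
    have h1 := h _ ((evalWord_eq_iff b).2 FreeGroup.reduce.self)
    refine .of_reduce_eq ?_
    exact (FreeGroup.Red.sublist FreeGroup.reduce.red).eq_of_length_le h1
  · intro h u hu
    rw [← h.reduce_eq, ← FreeGroup.reduce.sound ((evalWord_eq_iff b).1 hu)]
    exact FreeGroup.norm_mk_le

/-- For reduced words, nontrivial means nonempty and word length is length; every element is
represented by its reduced word. -/
theorem isShortestWord_iff {hs : List (GroupWord ι)} {w : GroupWord ι} :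
    (IsGeodesicWord (fun i => b i) w ∧ IsShortestNontrivial (fun i => b i)
      (wordSubgroup (fun i => b i) hs) (evalWord (fun i => b i) w)) ↔
    IsShortestWord (Subgroup.closure {g | ∃ h ∈ hs, FreeGroup.mk h = g}) w := by
  have hone : ∀ w : GroupWord ι, IsReduced w → (FreeGroup.mk w ≠ 1 ↔ w ≠ []) := by
    intro w hw
    rw [ne_eq, ne_eq, ← FreeGroup.toWord_eq_nil_iff, FreeGroup.toWord_mk, hw.reduce_eq]
  rw [isGeodesicWord_iff, IsShortestNontrivial, IsShortestWord]
  refine and_congr_right fun hw => ?_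
  rw [evalWord_mem_iff, ne_eq, evalWord_eq_one_iff, ← ne_eq, hone w hw]
  refine and_congr_right fun _ => and_congr_right fun _ => ?_
  constructor
  · intro h w' hw' hm hne
    have := h _ ((evalWord_mem_iff b).2 hm) fun h0 =>
      (hone w' hw').2 hne ((evalWord_eq_one_iff b).1 h0)
    rwa [wordLength_basis, wordLength_basis, hw.reduce_eq, hw'.reduce_eq] at this
  · intro h k hk hne
    obtain ⟨x, rfl⟩ := b.repr.symm.surjective k
    have hx : b.repr.symm x = evalWord (fun i => b i) x.toWord := by
      rw [evalWord_basis, FreeGroup.mk_toWord]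
    rw [hx] at hk hne ⊢
    rw [wordLength_basis, wordLength_basis, hw.reduce_eq, FreeGroup.reduce_toWord]
    have hred : IsReduced x.toWord := FreeGroup.isReduced_toWord
    exact h _ hred ((evalWord_mem_iff b).1 hk)
      ((hone _ hred).1 fun h0 => hne ((evalWord_eq_one_iff b).2 h0))

end FreeBasis

/-! ### Correctness of the algorithm -/

namespace StackProg

open LabelledGraph

variable {r : ℕ}

/-- The graph with edges `E`. -/
def listGraph (E : List (Edge r)) : LabelledGraph (Fin r) where
  V := ℕ
  base := 0
  E u i v := (u, (i, true), v) ∈ E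

/-- A list that contains with each edge its inverse. -/
def InvClosed (E : List (Edge r)) : Prop := ∀ ⦃u l v⦄, (u, l, v) ∈ E → (v, linv l, u) ∈ E

theorem linv_linv (l : Letter r) : linv (linv l) = l := by simp [linv]

theorem listGraph_reads {E : List (Edge r)} (hE : InvClosed E) {u v : ℕ} {l : Letter r} :
    (listGraph E).Reads u l v ↔ (u, l, v) ∈ E := by
  obtain ⟨i, b⟩ := l
  cases b
  · exact ⟨fun h => hE (l := (i, true)) h, fun h => hE (l := (i, false)) h⟩
  · exact Iff.rfl

theorem listGraph_walk_map {E E' : List (Edge r)} {f : ℕ → ℕ}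
    (hf : ∀ u l v, (u, l, v) ∈ E → (f u, l, f v) ∈ E') {u v : ℕ} {w : GroupWord (Fin r)}
    (h : (listGraph E).Walk u w v) : (listGraph E').Walk (f u) w (f v) := by
  induction w generalizing u with
  | nil =>
    obtain rfl : u = v := walk_nil_iff.1 h
    exact .nil _
  | cons l w ih =>
    obtain ⟨x, hr, h⟩ := walk_cons_iff.1 h
    refine .cons ?_ (ih h)
    obtain ⟨i, b⟩ := l
    cases b <;> exact hf _ _ _ hr

/-- The graph with edges `E` maps to the cosets of `H` by `c`, and the words `hs` can be read along
loops at its base vertex. -/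
structure Presents (H : Subgroup (FreeGroup (Fin r))) (c : ℕ → FreeGroup (Fin r) ⧸ H)
    (hs : List (GroupWord (Fin r))) (E : List (Edge r)) : Prop where
  inv : InvClosed E
  coset : (listGraph E).IsCosetMap H c
  loop : ∀ h ∈ hs, (listGraph E).Walk (0 : ℕ) h (0 : ℕ)
  length_le : ∀ h ∈ hs, h.length ≤ E.length

variable {H : Subgroup (FreeGroup (Fin r))} {c : ℕ → FreeGroup (Fin r) ⧸ H}
  {hs : List (GroupWord (Fin r))} {E : List (Edge r)}

theorem relabel_eq (p : ℕ × ℕ) (x : ℕ) : relabel p x = if x = p.1 then p.2 else x := by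
  rw [relabel, Bool.cond_eq_ite]
  simp only [decide_eq_true_eq]

theorem mem_rename {p : ℕ × ℕ} {e : Edge r} : e ∈ rename p E ↔
    ∃ u l v, (u, l, v) ∈ E ∧ (relabel p u, l, relabel p v) = e := by
  rw [rename, List.mem_map]
  exact ⟨fun ⟨⟨u, l, v⟩, h, h'⟩ => ⟨u, l, v, h, h'⟩, fun ⟨u, l, v, h, h'⟩ => ⟨(u, l, v), h, h'⟩⟩

theorem rename_walk (p : ℕ × ℕ) {u v : ℕ} {w : GroupWord (Fin r)}
    (h : (listGraph E).Walk u w v) :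
    (listGraph (rename p E)).Walk (relabel p u) w (relabel p v) :=
  listGraph_walk_map (fun u l v h => mem_rename.2 ⟨u, l, v, h, rfl⟩) h

theorem length_rename (p : ℕ × ℕ) (E : List (Edge r)) : (rename p E).length = E.length :=
  List.length_map ..

theorem Presents.rename {p : ℕ × ℕ} (hp : c p.1 = c p.2) (h0 : relabel p 0 = 0)
    (h : Presents H c hs E) : Presents H c hs (rename p E) where
  inv := by
    intro u l v he
    obtain ⟨u', l', v', he', h'⟩ := mem_rename.1 he
    obtain ⟨rfl, rfl, rfl⟩ := by simpa only [Prod.mk.injEq] using h'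
    exact mem_rename.2 ⟨_, _, _, h.inv he', rfl⟩
  coset :=
    { base := h.coset.base
      edge := by
        intro u i v he
        obtain ⟨u', l', v', he', h'⟩ := mem_rename.1 he
        obtain ⟨rfl, rfl, rfl⟩ := by simpa only [Prod.mk.injEq] using h'
        have hc : ∀ x, c (relabel p x) = c x := by
          intro x
          rw [relabel_eq]
          split_ifs with hx
          · rw [hx, hp]
          · rfl
        rw [hc, hc]
        exact h.coset.edge he' }
  loop := fun w hw => by
    have := rename_walk p (h.loop w hw)
    rwa [h0] at this
  length_le := fun w hw => by
    rw [length_rename]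
    exact h.length_le w hw

theorem Presents.foldStep (h : Presents H c hs E) : Presents H c hs (foldStep E) := by
  unfold StackProg.foldStep
  cases hp : conflict E with
  | none => exact h
  | some p =>
    obtain ⟨u, l, h1, h2, h3⟩ := conflict_spec hp
    have h4 := h.coset.reads ((listGraph_reads h.inv).2 h1)
    have h5 := h.coset.reads ((listGraph_reads h.inv).2 h2)
    -- The conflicting edges have the same source and letter, so cancelling the action of the letter
    -- gives equal cosets of their targets. The renamed vertex is larger than another one, hence is
    -- not the base vertex 0.
    refine h.rename (smul_left_cancel _ (h5.trans h4.symm)) ?_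
    rw [relabel_eq, if_neg (by omega)]

theorem foldAll_eq (E : List (Edge r)) : foldAll E = StackProg.foldStep^[E.length] E := by
  unfold foldAll
  rw [List.foldl_const]

theorem Presents.foldAll (h : Presents H c hs E) : Presents H c hs (foldAll E) := by
  rw [foldAll_eq]
  generalize E.length = n
  induction n with
  | zero => exact h
  | succ n ih =>
    rw [Function.iterate_succ_apply']
    exact ih.foldStep

/-- This measure makes folding terminate: the renamed vertex was the target of an edge and
disappears, while its replacement was already a target. -/
theorem card_targets_rename_lt {p : ℕ × ℕ} (h : conflict E = some p) :
    ((rename p E).map fun e => e.2.2).toFinset.card < (E.map fun e => e.2.2).toFinset.card := by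
  obtain ⟨u, l, h1, h2, h3⟩ := conflict_spec h
  refine Finset.card_lt_card (Finset.ssubset_iff_of_subset ?_ |>.2 ⟨p.1, ?_, ?_⟩)
  · intro x hx
    obtain ⟨e, he, rfl⟩ := List.mem_map.1 (List.mem_toFinset.1 hx)
    obtain ⟨u', l', v, he', rfl⟩ := mem_rename.1 he
    rw [List.mem_toFinset, List.mem_map]
    change ∃ a ∈ E, a.2.2 = relabel p v
    rw [relabel_eq]
    split_ifs
    · exact ⟨_, h1, rfl⟩
    · exact ⟨_, he', rfl⟩
  · exact List.mem_toFinset.2 (List.mem_map.2 ⟨_, h2, rfl⟩)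
  · intro hx
    obtain ⟨e, he, h'⟩ := List.mem_map.1 (List.mem_toFinset.1 hx)
    obtain ⟨u, l, v, he, rfl⟩ := mem_rename.1 he
    change relabel p v = p.1 at h'
    rw [relabel_eq] at h'
    split_ifs at h' with hv
    · omega
    · exact hv h'

theorem foldStep_of_conflict_eq_none (h : conflict E = none) : StackProg.foldStep E = E := by
  unfold StackProg.foldStep
  rw [h]
  rfl

/-- Every effective step loses a target, and a graph without conflicts is a fixed point, so surplus
steps do no harm. There are at most as many targets as edges, which justifies the number of steps in
`foldAll`. -/
theorem conflict_iterate_foldStep {n : ℕ} {E : List (Edge r)}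
    (h : (E.map fun e => e.2.2).toFinset.card ≤ n) :
    conflict (StackProg.foldStep^[n] E) = none := by
  induction n generalizing E with
  | zero =>
    have : E = [] := by simpa using h
    subst this
    rfl
  | succ n ih =>
    rw [Function.iterate_succ_apply]
    cases hp : conflict E with
    | none =>
      have h1 := foldStep_of_conflict_eq_none hp
      rw [h1, Function.iterate_fixed h1, hp]
    | some p =>
      have h1 : StackProg.foldStep E = StackProg.rename p E := by
        unfold StackProg.foldStep
        rw [hp]
        rfl
      have := card_targets_rename_lt hp
      exact ih (by rw [h1]; omega)

theorem conflict_foldAll (E : List (Edge r)) : conflict (foldAll E) = none := by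
  rw [foldAll_eq]
  refine conflict_iterate_foldStep ((List.toFinset_card_le _).trans ?_)
  rw [List.length_map]

theorem le_of_conflict_eq_none (h : conflict E = none) {u v v' : ℕ} {l : Letter r}
    (he : (u, l, v) ∈ E) (he' : (u, l, v') ∈ E) : v' ≤ v := by
  by_contra hlt
  have h1 := List.filterMap_eq_nil_iff.1 (List.head?_eq_none_iff.1 h) _ he
  have h2 := List.filterMap_eq_nil_iff.1 (List.head?_eq_none_iff.1 h1) _ he'
  simp only [decide_true, Bool.true_and, Bool.cond_eq_ite, decide_eq_true_eq] at h2
  rw [if_pos (not_le.1 hlt)] at h2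
  exact Option.some_ne_none _ h2

theorem deterministic_of_conflict_eq_none (hE : InvClosed E) (h : conflict E = none) :
    (listGraph E).Deterministic := by
  intro u l v v' h1 h2
  have h3 := (listGraph_reads hE).1 h1
  have h4 := (listGraph_reads hE).1 h2
  exact Nat.le_antisymm (le_of_conflict_eq_none h h4 h3) (le_of_conflict_eq_none h h3 h4)

/-! ### The bouquet of loops -/

/-- The state `s` of the construction arises by reading the words `hs` and an initial segment `w` of
the next word. -/
structure IsBuildState (H : Subgroup (FreeGroup (Fin r))) (c : ℕ → FreeGroup (Fin r) ⧸ H)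
    (hs : List (GroupWord (Fin r))) (w : GroupWord (Fin r)) (s : ℕ × ℕ × List (Edge r)) :
    Prop where
  presents : Presents H c hs s.2.2
  lt : s.1 < s.2.1
  edge_lt : ∀ u l v, (u, l, v) ∈ s.2.2 → u < s.2.1
  walk : (listGraph s.2.2).Walk (0 : ℕ) w s.1
  length_le : w.length ≤ s.2.2.length

theorem IsBuildState.letter {w : GroupWord (Fin r)} {s : ℕ × ℕ × List (Edge r)}
    (h : IsBuildState H c hs w s) (l : Letter r) :
    ∃ c', IsBuildState H c' hs (w ++ [l]) (buildStep s (some l)) := by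
  obtain ⟨m, n, E⟩ := s
  obtain ⟨hp, hlt, hE, hw, hlen⟩ := h
  dsimp only at hp hlt hE hw hlen
  have hsub : ∀ u l' v, (u, l', v) ∈ E → (u, l', v) ∈ (m, l, n) :: (n, linv l, m) :: E :=
    fun _ _ _ h => List.mem_cons_of_mem _ (List.mem_cons_of_mem _ h)
  have hinv : InvClosed ((m, l, n) :: (n, linv l, m) :: E) := by
    intro u l' v he
    rcases List.mem_cons.1 he with he | he
    · obtain ⟨rfl, rfl, rfl⟩ := by simpa only [Prod.mk.injEq] using he
      exact List.mem_cons_of_mem _ List.mem_cons_self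
    · rcases List.mem_cons.1 he with he | he
      · obtain ⟨rfl, rfl, rfl⟩ := by simpa only [Prod.mk.injEq] using he
        rw [linv_linv]
        exact List.mem_cons_self
      · exact hsub _ _ _ (hp.inv he)
  have hread : (listGraph ((m, l, n) :: (n, linv l, m) :: E)).Reads m l n :=
    (listGraph_reads hinv).2 List.mem_cons_self
  -- The fresh vertex `n` gets the only coset compatible with the new edge from `m`.
  refine ⟨Function.update c n ((FreeGroup.mk [l])⁻¹ • c m), ⟨hinv, ⟨?_, ?_⟩,
    fun w' hw' => ?_, fun w' hw' => ?_⟩, ?_, ?_, ?_, ?_⟩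
  · change Function.update c n _ 0 = _
    rw [Function.update_of_ne (by omega)]
    exact hp.coset.base
  · intro u i v he
    have hm : Function.update c n ((FreeGroup.mk [l])⁻¹ • c m) m = c m :=
      Function.update_of_ne hlt.ne _ _
    have hn : Function.update c n ((FreeGroup.mk [l])⁻¹ • c m) n = (FreeGroup.mk [l])⁻¹ • c m :=
      Function.update_self _ _ _
    rcases List.mem_cons.1 he with he | he
    · obtain ⟨rfl, rfl, rfl⟩ := by simpa only [Prod.mk.injEq] using he
      rw [hm, hn]
      exact smul_inv_smul _ _
    · rcases List.mem_cons.1 he with he | he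
      · obtain ⟨hu, h1⟩ := Prod.mk.inj he
        obtain ⟨hl, hv⟩ := Prod.mk.inj h1
        obtain rfl : l = (i, false) := by rw [← linv_linv l, ← hl]; rfl
        rw [hu, hv, hm, hn]
        rfl
      -- Old edges do not meet `n`: `hE` bounds sources, and a target is the source of the inverse
      -- edge.
      · have h1 := Function.update_of_ne (hE _ _ _ he).ne ((FreeGroup.mk [l])⁻¹ • c m) c
        have h2 := Function.update_of_ne (hE _ _ _ (hp.inv he)).ne ((FreeGroup.mk [l])⁻¹ • c m) c
        rw [h1, h2]
        exact hp.coset.edge he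
  · exact listGraph_walk_map (f := id) hsub (hp.loop w' hw')
  · have := hp.length_le w' hw'
    change _ ≤ E.length + 2
    omega
  · exact Nat.lt_succ_self n
  · intro u l' v he
    change u < n + 1
    rcases List.mem_cons.1 he with he | he
    · obtain ⟨rfl, rfl, rfl⟩ := by simpa only [Prod.mk.injEq] using he
      omega
    · rcases List.mem_cons.1 he with he | he
      · obtain ⟨rfl, rfl, rfl⟩ := by simpa only [Prod.mk.injEq] using he
        omega
      · exact (hE _ _ _ he).trans (Nat.lt_succ_self n)
  · exact (listGraph_walk_map (f := id) hsub hw).append (.single hread)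
  · change _ ≤ E.length + 2
    rw [List.length_append, List.length_singleton]
    omega

/-- The loop is closed by renaming the current vertex to the base vertex. Its coset is that of
`w⁻¹`, which is trivial because `w` lies in `H`, so the coset map survives. -/
theorem IsBuildState.endOfWord {w : GroupWord (Fin r)} {s : ℕ × ℕ × List (Edge r)}
    (h : IsBuildState H c hs w s) (hw : FreeGroup.mk w ∈ H) :
    IsBuildState H c (hs ++ [w]) [] (buildStep s none) := by
  obtain ⟨m, n, E⟩ := s
  obtain ⟨hp, hlt, hE, hwalk, hlen⟩ := h
  dsimp only at hp hlt hE hwalk hlen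
  have h0 : relabel (m, 0) 0 = 0 := by
    rw [relabel_eq]
    split_ifs <;> rfl
  have hm : relabel (m, 0) m = 0 := by
    rw [relabel_eq, if_pos rfl]
  have hc : c m = c 0 := by
    have h1 := hp.coset.walk hwalk
    have h2 := hp.coset.base
    change c 0 = _ at h2
    rw [h2, ← eq_inv_smul_iff, MulAction.Quotient.smul_coe, smul_eq_mul, mul_one] at h1
    rw [h1, h2, QuotientGroup.eq, inv_inv, mul_one]
    exact hw
  have h1 := hp.rename (p := (m, 0)) hc h0
  have h2 := rename_walk (m, 0) hwalk
  rw [h0, hm] at h2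
  refine ⟨⟨h1.inv, h1.coset, fun w' hw' => ?_, fun w' hw' => ?_⟩, ?_, ?_, .nil _, Nat.zero_le _⟩
  · rcases List.mem_append.1 hw' with hw' | hw'
    · exact h1.loop w' hw'
    · rw [List.mem_singleton.1 hw']
      exact h2
  · rcases List.mem_append.1 hw' with hw' | hw'
    · exact h1.length_le w' hw'
    · rw [List.mem_singleton.1 hw']
      change _ ≤ (rename (m, 0) E).length
      rwa [length_rename]
  · change 0 < n
    omega
  · intro u l v he
    change u < n
    obtain ⟨u', l', v', he', h'⟩ := mem_rename.1 he
    obtain ⟨rfl, rfl, rfl⟩ := by simpa only [Prod.mk.injEq] using h'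
    have := hE _ _ _ he'
    rw [relabel_eq]
    split_ifs <;> omega

theorem IsBuildState.letters {w : GroupWord (Fin r)} {s : ℕ × ℕ × List (Edge r)}
    (h : IsBuildState H c hs w s) (w' : GroupWord (Fin r)) :
    ∃ c', IsBuildState H c' hs (w ++ w') ((w'.map some).foldl buildStep s) := by
  induction w' generalizing w s c with
  | nil => exact ⟨c, by simpa using h⟩
  | cons l w' ih =>
    obtain ⟨c', h'⟩ := h.letter l
    obtain ⟨c', h'⟩ := ih h'
    exact ⟨c', by simpa using h'⟩

theorem IsBuildState.words {s : ℕ × ℕ × List (Edge r)} (h : IsBuildState H c hs [] s)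
    (hs' : List (GroupWord (Fin r))) (hH : ∀ h ∈ hs', FreeGroup.mk h ∈ H) :
    ∃ c', IsBuildState H c' (hs ++ hs') [] ((encodeInstance hs').foldl buildStep s) := by
  induction hs' generalizing hs s c with
  | nil => exact ⟨c, by simpa [encodeInstance] using h⟩
  | cons w hs' ih =>
    obtain ⟨c', h'⟩ := h.letters w
    obtain ⟨c', h'⟩ := ih (h'.endOfWord (hH w List.mem_cons_self))
      fun h hh => hH h (List.mem_cons_of_mem _ hh)
    exact ⟨c', by simpa [encodeInstance] using h'⟩

theorem exists_presents_buildState (hH : ∀ h ∈ hs, FreeGroup.mk h ∈ H) :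
    ∃ c, Presents H c hs (buildState (encodeInstance hs)).2.2 := by
  have h0 : IsBuildState H (fun _ => ((1 : FreeGroup (Fin r)) : FreeGroup (Fin r) ⧸ H)) [] []
      ((0, 1, []) : ℕ × ℕ × List (Edge r)) :=
    { presents :=
        { inv := fun _ _ _ h => absurd h List.not_mem_nil
          coset := ⟨rfl, fun _ _ _ h => absurd h List.not_mem_nil⟩
          loop := fun _ h => absurd h List.not_mem_nil
          length_le := fun _ h => absurd h List.not_mem_nil }
      lt := Nat.one_pos
      edge_lt := fun _ _ _ h => absurd h List.not_mem_nil
      walk := .nil _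
      length_le := le_rfl }
  obtain ⟨c, h⟩ := h0.words hs hH
  exact ⟨c, h.presents⟩

/-! ### The search -/

theorem exists_mem_extend {P : List (Edge r × List (Letter r))} {e : Edge r}
    {p : Edge r × List (Letter r)} (he : e ∈ E) (hp : p ∈ P) (h1 : p.1.2.2 = e.1)
    (h2 : e.2.1 ≠ linv p.1.2.1) : ∃ w, (e, w) ∈ extend E P := by
  let f : Edge r → Edge r × List (Letter r) → Option (Edge r × List (Letter r)) := fun e p =>
    bif decide (p.1.2.2 = e.1) && !decide (e.2.1 = linv p.1.2.1)
    then some (e, e.2.1 :: p.2) else none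
  have hf : f e p = some (e, e.2.1 :: p.2) := by simp [f, h1, h2]
  cases h : (P.filterMap (f e)).head? with
  | none =>
    have := List.filterMap_eq_nil_iff.1 (List.head?_eq_none_iff.1 h) p hp
    rw [hf] at this
    exact absurd this (Option.some_ne_none _)
  | some q =>
    have hq : q ∈ extend E P := List.mem_filterMap.2 ⟨e, he, h⟩
    obtain ⟨p', -, h'⟩ := List.mem_filterMap.1 (List.mem_of_mem_head? (Option.mem_def.2 h))
    simp only [f, Bool.cond_eq_ite] at h'
    split_ifs at h'
    obtain rfl := Option.some.inj h'
    exact ⟨_, hq⟩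

theorem ne_zero_of_closing_eq_none {P : List (Edge r × List (Letter r))} (h : closing P = none)
    {p : Edge r × List (Letter r)} (hp : p ∈ P) : p.1.2.2 ≠ 0 := by
  intro h0
  have := List.filterMap_eq_nil_iff.1 (List.head?_eq_none_iff.1 h) p hp
  simp [h0] at this

theorem isReduced_cons_cons_iff {l l' : Letter r} {w : List (Letter r)} :
    FreeGroup.IsReduced (l :: l' :: w) ↔ l ≠ linv l' ∧ FreeGroup.IsReduced (l' :: w) := by
  rw [FreeGroup.isReduced_cons_cons, linv, letter_ne_inv_iff]
  simp only [eq_comm]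

theorem isReduced_reverse {w : List (Letter r)} :
    FreeGroup.IsReduced w.reverse ↔ FreeGroup.IsReduced w := by
  rw [FreeGroup.IsReduced, FreeGroup.IsReduced, List.isChain_reverse]
  simp only [eq_comm]

/-- Labels are stored in reverse, so the head of `q.2` is the letter of the last edge and the
remaining word leads to the source of that edge. -/
theorem sound_searchState (hE : InvClosed E) {i : ℕ} : ∀ q ∈ (searchState E i).1,
    ∃ w, q.2 = q.1.2.1 :: w ∧ FreeGroup.IsReduced q.2 ∧ (listGraph E).Walk (0 : ℕ) w.reverse q.1.1
      := by
  induction i with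
  | zero =>
    intro q hq
    obtain ⟨-, h1, h2⟩ := mem_start.1 hq
    refine ⟨[], h2, ?_, ?_⟩
    · rw [h2]
      exact FreeGroup.IsReduced.singleton
    · rw [h1]
      exact .nil _
  | succ i ih =>
    intro q hq
    rw [searchState_succ] at hq
    obtain ⟨-, p, hp, h1, h2, h3⟩ := mem_extend hq
    obtain ⟨w, h4, h5, h6⟩ := ih p hp
    refine ⟨p.2, h3, ?_, ?_⟩
    · rw [h4] at h5
      rw [h3, h4, isReduced_cons_cons_iff]
      exact ⟨h2, h5⟩
    · rw [h4, List.reverse_cons, ← h1]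
      exact h6.append (.single ((listGraph_reads hE).2 (length_of_mem_searchState p hp).1))

/-- The search may store a different path `w'`, but it ends with the same edge. That suffices, since
the condition for appending another edge involves only the last one. -/
theorem complete_searchState (hE : InvClosed E) {w : List (Letter r)} {u v : ℕ} {l : Letter r}
    (hr : FreeGroup.IsReduced (l :: w)) (hw : (listGraph E).Walk (0 : ℕ) w.reverse u)
    (he : (u, l, v) ∈ E) : ∃ w', ((u, l, v), w') ∈ (searchState E w.length).1 := by
  induction w generalizing u v l with
  | nil =>
    obtain rfl : 0 = u := walk_nil_iff.1 hw
    exact ⟨[l], mem_start.2 ⟨he, rfl, rfl⟩⟩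
  | cons l' w ih =>
    rw [List.reverse_cons] at hw
    obtain ⟨x, h1, h2⟩ := walk_append_iff.1 hw
    obtain ⟨y, h3, h4⟩ := walk_cons_iff.1 h2
    cases h4
    rw [isReduced_cons_cons_iff] at hr
    obtain ⟨w', h5⟩ := ih hr.2 h1 ((listGraph_reads hE).1 h3)
    rw [List.length_cons, searchState_succ]
    exact exists_mem_extend he h5 rfl hr.1

/-- The labels of the nonempty reduced loops at the base vertex. -/
def IsLoopWord (E : List (Edge r)) (w : GroupWord (Fin r)) : Prop :=
  FreeGroup.IsReduced w ∧ w ≠ [] ∧ (listGraph E).Walk (0 : ℕ) w (0 : ℕ)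

/-- The state after `i` steps stores paths of length `i + 1`, and these are tested for being closed
in the next step. So after `i` steps all loops of length at most `i` have been covered, and the
first one found is shortest. -/
theorem searchState_snd (hE : InvClosed E) (i : ℕ) :
    (∀ w, (searchState E i).2 = some w → IsLoopWord E w.reverse ∧
      ∀ w', IsLoopWord E w' → w.length ≤ w'.length) ∧
    ((searchState E i).2 = none → ∀ w', IsLoopWord E w' → i < w'.length) := by
  induction i with
  | zero =>
    exact ⟨fun w h => absurd h (Option.some_ne_none w).symm,
      fun _ w' h => List.length_pos_iff.2 h.2.1⟩
  | succ i ih =>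
    have hsucc : (searchState E (i + 1)).2 =
        (searchState E i).2.elim (closing (searchState E i).1) some := by
      rw [searchState_succ]
      rfl
    rw [hsucc]
    cases h : (searchState E i).2 with
    | some w0 =>
      refine ⟨fun w hw => ?_, fun h' => absurd h' (Option.some_ne_none _)⟩
      obtain rfl := Option.some.inj hw
      exact ih.1 _ h
    | none =>
      have hlt := ih.2 h
      constructor
      · intro w hw
        obtain ⟨p, hp, h0, rfl⟩ := closing_mem hw
        obtain ⟨h1, h2⟩ := length_of_mem_searchState p hp
        obtain ⟨w, h3, h4, h5⟩ := sound_searchState hE p hp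
        refine ⟨⟨isReduced_reverse.2 h4, by simp [h3], ?_⟩, fun w' hw' => ?_⟩
        · have h6 := h5.append (.single ((listGraph_reads hE).2 h1))
          rwa [h0, ← List.reverse_cons, ← h3] at h6
        · rw [h2]
          exact hlt w' hw'
      · intro hn w' hw'
        refine lt_of_le_of_ne (hlt w' hw') fun heq => ?_
        obtain ⟨h1, h2, h3⟩ := hw'
        rw [← isReduced_reverse] at h1
        rw [← List.reverse_reverse w'] at h3
        rw [← List.length_reverse] at heq
        cases hrev : w'.reverse with
        | nil => exact h2 (List.reverse_eq_nil_iff.1 hrev)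
        | cons l w =>
          rw [hrev, List.length_cons, Nat.add_right_cancel_iff] at heq
          rw [hrev] at h1
          rw [hrev, List.reverse_cons] at h3
          obtain ⟨x, h4, h5⟩ := walk_append_iff.1 h3
          obtain ⟨y, h6, h7⟩ := walk_cons_iff.1 h5
          cases h7
          -- A loop word of length `i + 1` would be represented by a stored path with the same last
          -- edge, which ends at the base vertex; `closing` would have noticed it.
          obtain ⟨w'', h8⟩ := complete_searchState hE h1 h4 ((listGraph_reads hE).1 h6)
          rw [← heq] at h8
          exact ne_zero_of_closing_eq_none hn h8 rfl

theorem solve_spec (hs : List (GroupWord (Fin r))) :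
    (∀ w, solve (encodeInstance hs) = some w →
      IsShortestWord (Subgroup.closure {g | ∃ h ∈ hs, FreeGroup.mk h = g}) w.reverse) ∧
    (solve (encodeInstance hs) = none →
      Subgroup.closure {g | ∃ h ∈ hs, FreeGroup.mk h = g} = ⊥) := by
  obtain ⟨c, hE⟩ := exists_presents_buildState (hs := hs)
    (H := Subgroup.closure {g | ∃ h ∈ hs, FreeGroup.mk h = g})
    fun h hh => Subgroup.subset_closure ⟨h, hh, rfl⟩
  replace hE := hE.foldAll
  have hdet := deterministic_of_conflict_eq_none hE.inv (conflict_foldAll _)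
  have hsolve : solve (encodeInstance hs) =
    search (foldAll (buildState (encodeInstance hs)).2.2) := rfl
  rw [hsolve, search_eq]
  generalize foldAll (buildState (encodeInstance hs)).2.2 = E at hE hdet
  have key : ∀ w, IsLoopWord E w ↔ FreeGroup.IsReduced w ∧ w ≠ [] ∧
      FreeGroup.mk w ∈ Subgroup.closure {g | ∃ h ∈ hs, FreeGroup.mk h = g} := fun w =>
    and_congr_right fun hw => and_congr_right fun _ =>
      walk_base_iff hE.coset hdet rfl hE.loop hw
  obtain ⟨h1, h2⟩ := searchState_snd hE.inv E.length
  constructor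
  · intro w hw
    obtain ⟨h3, h4⟩ := h1 w hw
    obtain ⟨h5, h6, h7⟩ := (key _).1 h3
    refine ⟨h5, h7, h6, fun w' hw' hm hne => ?_⟩
    rw [List.length_reverse]
    exact h4 w' ((key w').2 ⟨hw', hne, hm⟩)
  · intro hn
    rw [eq_bot_iff, Subgroup.closure_le]
    rintro g ⟨h, hh, rfl⟩
    change FreeGroup.mk h = 1
    by_contra hne
    rw [← FreeGroup.toWord_eq_nil_iff, FreeGroup.toWord_mk] at hne
    -- If the search fails, all loop words are longer than `E`. But a nontrivial generator would
    -- have a reduced form labelling a loop, and this is no longer than the generator, hence no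
    -- longer than `E`.
    have h3 := h2 hn (FreeGroup.reduce h) ⟨.of_reduce_eq FreeGroup.reduce.idem, hne,
      (hE.loop h hh).reduce hdet⟩
    have h4 : (FreeGroup.reduce h).length ≤ h.length := FreeGroup.norm_mk_le
    have h5 := hE.length_le h hh
    omega

end StackProg

/-! ### From letters to the symbols of the machine -/

namespace StackProg

section

open TreeEnc (enc)

variable {r N : ℕ}

theorem decode_PT (e : Option (Letter r) ≃ Fin N) : PT N fun i : Fin N => e.symm i :=
  PT.finCases (F := fun i (_ : Fin N) => e.symm i) PT.id fun i => PT.const (e.symm i)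

/-- The alphabet is finite, so the code is a table looked up by generator and sign. -/
theorem encode_PT (e : Option (Letter r) ≃ Fin N) : PT N fun l : Letter r => e (some l) := by
  convert PT.finCases (F := fun i (l : Letter r) => bif l.2 then e (some (i, true))
    else e (some (i, false))) (PT.id (N := N) (α := Letter r)).fst
    fun i => PT.cond PT.id.snd (PT.const _) (PT.const _) using 2 with l
  obtain ⟨i, b⟩ := l
  cases b <;> rfl

theorem enc_listFin (L : List (Fin N)) : enc L = T.ofList (L.map Fin.val) := by
  induction L with
  | nil => rfl
  | cons i L ih =>
    rw [enc_cons, ih]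
    rfl

/-- A function on lists of symbols from which a Turing machine solves the shortest element
problem. -/
def solveCodes (e : Option (Letter r) ≃ Fin N) (L : List (Fin N)) : List (Fin N) :=
  (solve (L.reverse.map fun i => e.symm i)).elim [] fun w =>
    (e none :: (w.map fun l => e (some l)).reverse).reverse

theorem solveCodes_PT (e : Option (Letter r) ≃ Fin N) : PT N (solveCodes e) :=
  PT.elim (g := fun q : List (Fin N) × List (Letter r) =>
      (e none :: (q.2.map fun l => e (some l)).reverse).reverse)
    (solve_PT.comp (PT.map (f := fun q : List (Fin N) × Fin N => e.symm q.2) PT.id.reverse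
      ((decode_PT e).comp PT.id.snd)))
    (PT.const [])
    (PT.cons (PT.const (e none)) (PT.map (f := fun q : (List (Fin N) × List (Letter r)) × Letter r =>
      e (some q.2)) PT.id.snd ((encode_PT e).comp PT.id.snd)).reverse).reverse

/-- Reading and writing both reverse their lists, and the search yields reversed words. The
reversals in `solveCodes` undo these. -/
theorem nonempty_computable_solve (r : ℕ) :
    Nonempty (Turing.TM2ComputableInPolyTime (encodeInstance (ι := Fin r)) encodeAnswer
      fun hs => (solve (encodeInstance hs)).map List.reverse) := by
  let N := Fintype.card (Option (Letter r))
  -- Because of the marker `none` the alphabet is nonempty even for rank 0.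
  have : NeZero N := ⟨Fintype.card_ne_zero⟩
  let e : Option (Letter r) ≃ Fin N := Fintype.equivFin _
  refine PFun.computable e _ _ _ ?_
  have h := (solveCodes_PT e).pullback fun hs : List (GroupWord (Fin r)) =>
    ((encodeInstance hs).map fun x => e x).reverse
  convert h using 2 with hs hs
  · rw [enc_listFin, List.map_reverse, List.map_map]
    rfl
  · have h1 : (((encodeInstance hs).map fun x => e x).reverse.reverse.map fun i => e.symm i) =
        encodeInstance hs := by
      simp
    rw [solveCodes, h1]
    cases solve (encodeInstance hs) with
    | none => rfl
    | some w =>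
      simp only [Option.map_some, Option.elim_some]
      rw [enc_listFin]
      simp [encodeAnswer, Function.comp_def]

end

end StackProg

theorem mainTheorem11 (r : ℕ) {G : Type*} [Group G] (b : FreeGroupBasis (Fin r) G) :
    ShortestElementProblemInP (fun i => b i) ∧
    ∀ (hs : List (GroupWord (Fin r))) (w : GroupWord (Fin r)),
      (IsGeodesicWord (fun i => b i) w ∧
        IsShortestNontrivial (fun i => b i) (wordSubgroup (fun i => b i) hs)
          (evalWord (fun i => b i) w)) ↔
      ∃ p : List (LabelledStep (stallingsGraph hs).V (Fin r)),
        (stallingsGraph hs).IsShortestReducedLoop p ∧ p.map LabelledStep.lab = w := by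
  refine ⟨⟨_, fun hs => ?_, StackProg.nonempty_computable_solve r⟩,
    fun hs w => (isShortestWord_iff b).trans exists_isShortestReducedLoop_iff.symm⟩
  obtain ⟨h1, h2⟩ := StackProg.solve_spec hs
  cases h : StackProg.solve (encodeInstance hs) with
  | none =>
    change wordSubgroup (fun i => b i) hs = ⊥
    rw [wordSubgroup_basis, h2 h, Subgroup.map_bot]
  | some w => exact ((isShortestWord_iff b).2 (h1 w h)).2
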